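/- **Setting.** Let $X=\{x_1,\dots,x_n\}$. GBC-expressions over $X$ are given by $\varphi ::= \top \mid \bot \mid x \mid \neg\varphi \mid \varphi\circledast\psi \mid \pi_{[x:=b]}\varphi \mid \varphi[y/x]$, where $x,y\in X$, $b\in\{0,1\}$, $\circledast:\{0,1\}^2\to\{0,1\}$ is any boolean operator, and $\varphi[y/x]$ ("substitute $y$ for $x$") is allowed only if $y\notin \mathrm{Free}(\varphi)$. Here $\mathrm{Free}$ is defined as usual: $\mathrm{Free}(\top)=\mathrm{Free}(\bot)=\emptyset$, $\mathrm{Free}(x)=\{x\}$, $\mathrm{Free}(\neg\varphi)=\mathrm{Free}(\varphi)$, $\mathrm{Free}(\varphi\circledast\psi)=\mathrm{Free}(\varphi)\cup\mathrm{Free}(\psi)$, $\mathrm{Free}(\pi_{[x:=b]}\varphi)=\mathrm{Free}(\varphi)\setminus\{x\}$, and $\mathrm{Free}(\varphi[y/x])$ is $\mathrm{Free}(\varphi)$ with $x$, if present, replaced by $y$. Each expression has the obvious boolean function $\mathrm{fn}(\varphi):\{0,1\}^X\to\{0,1\}$. A generalized boolean circuit (GBC) $\varphi$ is given by a finite set of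 output expressions; it has one gate for each subexpression of an output, and $|\varphi|$ is its number of gates. Let $p\ge 2^n$ be an odd prime and $\mathbb F=\mathbb F_p$. The arithmetization $[\![\varphi]\!]\in\mathbb F[x_1,\dots,x_n]$ is defined by $[\![\top]\!]=1$, $[\![\bot]\!]=0$, $[\![x]\!]=x$, $[\![\neg\varphi]\!]=1-[\![\varphi]\!]$, $[\![\varphi\circledast\psi]\!]=[\![\varphi]\!]\,\widehat\circledast\,[\![\psi]\!]$ with $\widehat\circledast$ the multilinear extension of $\circledast$ (e.g. $a\,\widehat\wedge\, b=ab$, $a\,\widehat\vee\, b=a+b-ab$), while $\pi_{[x:=b]}$ and $[y/x]$ act by substituting $b$, respectively $y$, for $x$. A degree-reduction gate $\delta_x\varphi$ has $\mathrm{fn}(\delta_x\varphi)=\mathrm{fn}(\varphi)$, $\mathrm{Free}(\delta_x\varphi)=\mathrm{Free}(\varphi)$, and $[\![\delta_x\varphi]\!]$ is obtained from $[\![\varphi]\!]$ by replacing the exponent $d$ of $x$ by $\min(d,1)$ in every monomial. The degree-reduced circuit $\mathrm{conv}(\varphi)$ is obtained from $\varphi$ by replacing every gate $\psi_1\circledast\psi_2$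 by $\delta_{x_1}(\delta_{x_2}(\cdots\delta_{x_n}(\psi_1\circledast\psi_2)))$. **Claims.** $\mathcal C$ is a finite collection of claims about gates of $\mathrm{conv}(\varphi)$ that correspond to gates of $\varphi$ (not about the auxiliary gates inside the chains introduced by $\mathrm{conv}$). A claim has one of the forms: ($\mathbb F$-evaluation) $[\![\psi]\!](\sigma)=k$ with $\sigma\in\mathbb F^X$, $k\in\mathbb F$; ($\mathbb B$-evaluation) $\mathrm{fn}(\psi)(\tau)=b$ with $\tau\in\{0,1\}^X$, $b\in\{0,1\}$; (count) $\mathrm{fn}(\psi)$, as a function of the variables $\mathrm{Free}(\psi)$, has exactly $k$ satisfying assignments, $k\in\{0,\dots,p-1\}$; (equivalence) $\mathrm{fn}(\psi_1)=\mathrm{fn}(\psi_2)$, or $\mathrm{fn}(\psi_1)\ne\mathrm{fn}(\psi_2)$. **Protocol.** Verifier can ask Prover for $[\![\psi]\!](\sigma)$ (answer: an element of $\mathbb F$); for $[\![\psi]\!]$ with all variables but $x$ assigned by $\sigma$ (answer: a polynomial in one variable); or for an assignment $\sigma$ with $[\![\psi_1]\!](\sigma)\neq[\![\psi_2]\!](\sigma)$.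 A Prover is an arbitrary, possibly randomized, strategy whose answers may depend on all previous challenges and answers. A Prover is honest if every answer is truthful (for the last kind of challenge: if a distinguishing $\sigma$ exists). $\mathbb F$-evaluation claims about $\psi$ whose assignments agree on $\mathrm{Free}(\psi)$ are identified when their values agree. Verifier proceeds as follows. 1. *Normalize.* Replace each claim of $\mathcal C$ by $\mathbb F$-evaluation claims. $\mathbb F$-evaluation claims are kept; $\mathrm{fn}(\psi)(\tau)=b$ becomes $[\![\psi]\!](\tau)=b$; a count claim with number $k$ becomes $[\![\psi]\!](2^{-1},\dots,2^{-1})=k\cdot2^{-|\mathrm{Free}(\psi)|}$. For $\mathrm{fn}(\psi_1)=\mathrm{fn}(\psi_2)$, draw $\sigma\in\mathbb F^X$ uniformly, ask for the values $a_i$ of $[\![\psi_i]\!](\sigma)$, reject if $a_1\ne a_2$, and otherwise add the claims $[\![\psi_i]\!](\sigma)=a_i$, $i=1,2$. For $\mathrm{fn}(\psi_1)\ne\mathrm{fn}(\psi_2)$, ask Prover for a distinguishing $\sigma$, ask for the values $a_i$ of $[\![\psi_i]\!](\sigma)$, reject if $a_1=a_2$, and otherwise add the claims $[\![\psi_i]\!](\sigma)=a_i$.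 2. *Rounds.* Visit the gates $\psi$ of $\mathrm{conv}(\varphi)$ in a topological order, every gate after its predecessors; skip gates about which there is no claim. - *Merge*, if there are at least two claims about $\psi$: for each $x\in\mathrm{Free}(\psi)$ in turn, for every claim $[\![\psi]\!](\sigma)=k$ ask for the polynomial $q$ of $[\![\psi]\!]$ in $x$ with the other variables assigned by $\sigma$, and reject unless $\deg q\le2$ and $q(\sigma(x))=k$; then draw one $r\in\mathbb F$ uniformly and replace every claim by $[\![\psi]\!](\sigma[x:=r])=q(r)$. At the end, reject unless exactly one claim is left. - Let $[\![\psi]\!](\sigma)=k$ be the single claim about $\psi$. If $\psi$ is $\top$, $\bot$ or a variable, reject if the claim is false. If $\psi=\neg\psi_1$ or $\psi=\psi_1\circledast\psi_2$, ask for the values $a_i$ of $[\![\psi_i]\!](\sigma)$, reject unless $1-a_1=k$, respectively $a_1\,\widehat\circledast\, a_2=k$, and add the claims $[\![\psi_i]\!](\sigma)=a_i$. If $\psi=\delta_x\psi'$, ask for the polynomial $q$ of $[\![\psi']\!]$ in $x$ with the other variables assigned by $\sigma$, reject unless $\deg q\le2$ and $\sigma(x)q(1)+(1-\sigma(x))q(0)=k$,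 draw $r\in\mathbb F$ uniformly and add the claim $[\![\psi']\!](\sigma[x:=r])=q(r)$. If $\psi=\pi_{[x:=b]}\psi'$, add the claim $[\![\psi']\!](\sigma[x:=b])=k$. If $\psi=\psi'[y/x]$, add the claim $[\![\psi']\!](\sigma[x:=\sigma(y)])=k$. 3. If Verifier has not rejected after the last gate, she accepts. **Lemma.** If $\mathcal C$ contains a false claim, then for every Prover the probability that Verifier accepts is at most $\dfrac{4n|\varphi|+n}{|\mathbb F|}$. If all claims in $\mathcal C$ are true, then honest Provers exist, and Verifier accepts with probability $1$ when interacting with any honest Prover. -/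

import Mathlib

/-- Expressions over the boolean variables `x_0, …, x_{n-1}`: generalized boolean circuits (GBCs),
together with the degree-reduction gates `delta` that `conv` inserts.
`ren y x φ` is the renaming gate `φ[y/x]` (substitute `y` for `x`). -/
inductive GBC (n : ℕ) : Type
  | top : GBC n
  | bot : GBC n
  | var (x : Fin n) : GBC n
  | neg (φ : GBC n) : GBC n
  | bin (op : Bool → Bool → Bool) (φ ψ : GBC n) : GBC n
  | proj (x : Fin n) (b : Bool) (φ : GBC n) : GBC n
  | ren (y x : Fin n) (φ : GBC n) : GBC n
  | delta (x : Fin n) (φ : GBC n) : GBC n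
  deriving DecidableEq

namespace GBC

variable {n : ℕ}

/-- The free variables: the variables on which the value of the gate may depend. A projection
binds its variable; renaming `x` to `y` replaces `x` by `y`. -/
def free : GBC n → Finset (Fin n)
  | top => ∅
  | bot => ∅
  | var x => {x}
  | neg φ => φ.free
  | bin _ φ ψ => φ.free ∪ ψ.free
  | proj x _ φ => φ.free.erase x
  | ren y x φ => φ.free.image (fun z => if z = x then y else z)
  | delta _ φ => φ.free

/-- A GBC-expression proper: no degree-reduction gates, and every renaming `φ[y/x]` introduces a
variable `y` that is not free in `φ`. -/
def IsExpr : GBC n → Prop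
  | top => True
  | bot => True
  | var _ => True
  | neg φ => φ.IsExpr
  | bin _ φ ψ => φ.IsExpr ∧ ψ.IsExpr
  | proj _ _ φ => φ.IsExpr
  | ren y _ φ => φ.IsExpr ∧ y ∉ φ.free
  | delta _ _ => False

/-- The boolean function of a gate. -/
def fn : GBC n → (Fin n → Bool) → Bool
  | top, _ => true
  | bot, _ => false
  | var x, τ => τ x
  | neg φ, τ => !(φ.fn τ)
  | bin op φ ψ, τ => op (φ.fn τ) (ψ.fn τ)
  | proj x b φ, τ => φ.fn (Function.update τ x b)
  | ren y x φ, τ => φ.fn (Function.update τ x (τ y))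
  | delta _ φ, τ => φ.fn τ

/-- Immediate subexpressions. -/
def children : GBC n → Finset (GBC n)
  | top => ∅
  | bot => ∅
  | var _ => ∅
  | neg φ => {φ}
  | bin _ φ ψ => {φ, ψ}
  | proj _ _ φ => {φ}
  | ren _ _ φ => {φ}
  | delta _ φ => {φ}

/-- All subexpressions, the expression itself included. -/
def subexprs : GBC n → Finset (GBC n)
  | top => {top}
  | bot => {bot}
  | var x => {var x}
  | neg φ => insert (neg φ) φ.subexprs
  | bin op φ ψ => insert (bin op φ ψ) (φ.subexprs ∪ ψ.subexprs)
  | proj x b φ => insert (proj x b φ) φ.subexprs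
  | ren y x φ => insert (ren y x φ) φ.subexprs
  | delta x φ => insert (delta x φ) φ.subexprs

/-- Degree-reduce with respect to all variables: `δ_{x_0} (δ_{x_1} (⋯ δ_{x_{n-1}} φ))`. -/
def reduceAll (φ : GBC n) : GBC n :=
  (List.finRange n).foldr delta φ

/-- `conv φ`: every binary gate is followed by degree reductions for all variables. -/
def conv : GBC n → GBC n
  | top => top
  | bot => bot
  | var x => var x
  | neg φ => neg φ.conv
  | bin op φ ψ => (bin op φ.conv ψ.conv).reduceAll
  | proj x b φ => proj x b φ.conv
  | ren y x φ => ren y x φ.conv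
  | delta x φ => delta x φ.conv

end GBC

/-- The value `1` or `0` of a boolean in a ring. -/
def boolVal (R : Type*) [Ring R] (b : Bool) : R :=
  if b then 1 else 0

/-- Arithmetization of a binary boolean operator: its multilinear extension.
For instance `∧` becomes `a * b` and `∨` becomes `a + b - a * b`. -/
def arithOp {R : Type*} [Ring R] (op : Bool → Bool → Bool) (a b : R) : R :=
  boolVal R (op false false) * ((1 - a) * (1 - b)) + boolVal R (op false true) * ((1 - a) * b)
    + boolVal R (op true false) * (a * (1 - b)) + boolVal R (op true true) * (a * b)

noncomputable section

/-- Degree reduction `δ_x q`: in every monomial, replace the exponent `d` of `x` by `min d 1`. -/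
def degreeReduce {n p : ℕ} (x : Fin n) (q : MvPolynomial (Fin n) (ZMod p)) :
    MvPolynomial (Fin n) (ZMod p) :=
  ∑ m ∈ q.support, MvPolynomial.monomial (m.update x (min (m x) 1)) (q.coeff m)

/-- The arithmetization `⟦φ⟧` over the field with `p` elements. -/
def GBC.arith {n : ℕ} (p : ℕ) : GBC n → MvPolynomial (Fin n) (ZMod p)
  | .top => 1
  | .bot => 0
  | .var x => MvPolynomial.X x
  | .neg φ => 1 - φ.arith p
  | .bin op φ ψ => arithOp op (φ.arith p) (ψ.arith p)
  | .proj x b φ =>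
      MvPolynomial.aeval
        (fun z => if z = x then MvPolynomial.C (boolVal (ZMod p) b) else MvPolynomial.X z)
        (φ.arith p)
  | .ren y x φ => MvPolynomial.rename (fun z => if z = x then y else z) (φ.arith p)
  | .delta x φ => degreeReduce x (φ.arith p)

/-- Assignments of field elements to the variables. -/
abbrev Assignment (n p : ℕ) : Type := Fin n → ZMod p

/-- The univariate polynomial obtained from `q` by assigning `σ z` to every `z ≠ x`. -/
def evalExcept {n p : ℕ} (σ : Assignment n p) (x : Fin n) (q : MvPolynomial (Fin n) (ZMod p)) :
    Polynomial (ZMod p) :=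
  MvPolynomial.aeval (fun z => if z = x then Polynomial.X else Polynomial.C (σ z)) q

/-! ### Circuits -/

/-- The gates of the circuit with the given output expressions: one gate for each subexpression. -/
def circuitGates {n : ℕ} (outputs : Finset (GBC n)) : Finset (GBC n) :=
  outputs.biUnion GBC.subexprs

/-- A topological order of a set of gates: every gate is listed exactly once, and no gate is listed
before one of its predecessors, so the order runs from outputs to inputs. -/
def IsTopologicalOrder {n : ℕ} (gates : Finset (GBC n)) (order : List (GBC n)) : Prop :=
  order.Nodup ∧ (∀ ψ, ψ ∈ order ↔ ψ ∈ gates) ∧ order.Pairwise (fun a b => a ∉ b.children)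

/-! ### Claims -/

/-- The claims that can be made about gates. -/
inductive Claim (n p : ℕ) : Type
  /-- the polynomial of `ψ` takes the value `k` at `σ` -/
  | fieldEval (ψ : GBC n) (σ : Assignment n p) (k : ZMod p)
  /-- the boolean function of `ψ` takes the value `b` at `τ` -/
  | boolEval (ψ : GBC n) (τ : Fin n → Bool) (b : Bool)
  /-- the boolean function of `ψ` has exactly `k` satisfying assignments -/
  | count (ψ : GBC n) (k : ℕ)
  /-- the boolean functions of `ψ₁` and `ψ₂` are equal -/
  | equiv (ψ₁ ψ₂ : GBC n)
  /-- the boolean functions of `ψ₁` and `ψ₂` are different -/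
  | nequiv (ψ₁ ψ₂ : GBC n)

namespace Claim

variable {n p : ℕ}

/-- The gates that a claim is about. -/
def gates : Claim n p → Finset (GBC n)
  | fieldEval ψ _ _ => {ψ}
  | boolEval ψ _ _ => {ψ}
  | count ψ _ => {ψ}
  | equiv ψ₁ ψ₂ => {ψ₁, ψ₂}
  | nequiv ψ₁ ψ₂ => {ψ₁, ψ₂}

/-- The number in a count claim is represented by a field element, so it is less than `p`. -/
def InRange : Claim n p → Prop
  | count _ k => k < p
  | _ => True

/-- The claim is true. Satisfying assignments are assignments of the free variables. -/
def Holds : Claim n p → Prop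
  | fieldEval ψ σ k => MvPolynomial.eval σ (ψ.arith p) = k
  | boolEval ψ τ b => ψ.fn τ = b
  | count ψ k =>
      Fintype.card {τ : {x // x ∈ ψ.free} → Bool //
        ψ.fn (fun x => if h : x ∈ ψ.free then τ ⟨x, h⟩ else false) = true} = k
  | equiv ψ₁ ψ₂ => ψ₁.fn = ψ₂.fn
  | nequiv ψ₁ ψ₂ => ψ₁.fn ≠ ψ₂.fn

end Claim

/-! ### Interaction between Verifier and Prover -/

/-- Verifier's challenges. In `evalAt` all variables are assigned; in `evalExcept` the variable `x`
is unassigned (Verifier always sends `σ` with the entry at `x` blanked to `0`);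
`distinct` asks for an assignment at which the two polynomials differ. -/
inductive Challenge (n p : ℕ) : Type
  | evalAt (ψ : GBC n) (σ : Assignment n p)
  | evalExcept (ψ : GBC n) (σ : Assignment n p) (x : Fin n)
  | distinct (ψ₁ ψ₂ : GBC n)

/-- The type of Prover's answer to a challenge. -/
def Challenge.Answer {n p : ℕ} : Challenge n p → Type
  | evalAt _ _ => ZMod p
  | evalExcept _ _ _ => Polynomial (ZMod p)
  | distinct _ _ => Assignment n p

/-- The truthful answers to a challenge. -/
def Challenge.IsTruthful {n p : ℕ} : (c : Challenge n p) → c.Answer → Prop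
  | evalAt ψ σ, a => a = MvPolynomial.eval σ (ψ.arith p)
  | evalExcept ψ σ x, a => a = _root_.evalExcept σ x (ψ.arith p)
  | distinct ψ₁ ψ₂, a =>
      (∃ σ, MvPolynomial.eval σ (ψ₁.arith p) ≠ MvPolynomial.eval σ (ψ₂.arith p)) →
        MvPolynomial.eval a (ψ₁.arith p) ≠ MvPolynomial.eval a (ψ₂.arith p)

/-- What Prover has seen so far: the challenges received, with the answers given. -/
abbrev Transcript (n p : ℕ) : Type := List ((c : Challenge n p) × c.Answer)

/-- A Prover: an arbitrary (possibly randomized, computationally unbounded) strategy that answers a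
challenge depending on everything seen so far. -/
abbrev Prover (n p : ℕ) : Type := Transcript n p → (c : Challenge n p) → PMF c.Answer

/-- An honest Prover answers every challenge truthfully. -/
def Prover.Honest {n p : ℕ} (P : Prover n p) : Prop :=
  ∀ h c, ∀ a ∈ (P h c).support, c.IsTruthful a

/-- Programs of Verifier: return a result, reject, ask Prover, draw a uniformly random field
element, or draw a uniformly random assignment. -/
inductive Program (n p : ℕ) (α : Type) : Type
  | pure (a : α) : Program n p α
  | reject : Program n p α
  | ask (c : Challenge n p) (next : c.Answer → Program n p α) : Program n p α
  | sample (next : ZMod p → Program n p α) : Program n p α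
  | sampleAssignment (next : Assignment n p → Program n p α) : Program n p α

namespace Program

variable {n p : ℕ} {α β : Type}

/-- Sequential composition; a rejection stops the whole program. -/
def bind : Program n p α → (α → Program n p β) → Program n p β
  | pure a, f => f a
  | reject, _ => reject
  | ask c next, f => ask c (fun a => (next a).bind f)
  | sample next, f => sample (fun r => (next r).bind f)
  | sampleAssignment next, f => sampleAssignment (fun σ => (next σ).bind f)

/-- The distribution of the result of a program run against Prover `P` after the transcript `h`;
`none` means that Verifier has rejected. -/
def run [NeZero p] (P : Prover n p) : Program n p α → Transcript n p → PMF (Option α)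
  | pure a, _ => PMF.pure (some a)
  | reject, _ => PMF.pure none
  | ask c next, h => (P h c).bind (fun a => (next a).run P (h ++ [⟨c, a⟩]))
  | sample next, h => (PMF.uniformOfFintype (ZMod p)).bind (fun r => (next r).run P h)
  | sampleAssignment next, h =>
      (PMF.uniformOfFintype (Assignment n p)).bind (fun σ => (next σ).run P h)

end Program

/-! ### Verifier -/

/-- The claim that the polynomial of `gate` takes the value `val` at `asg`. -/
structure EvalClaim (n p : ℕ) : Type where
  gate : GBC n
  asg : Assignment n p
  val : ZMod p
  deriving DecidableEq

/-- The evaluation claim about `ψ`, where only the free variables of `ψ` matter: claims whose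
assignments agree on them are the same claim, so the other entries are blanked to `0`. -/
def EvalClaim.mk' {n p : ℕ} (ψ : GBC n) (σ : Assignment n p) (k : ZMod p) : EvalClaim n p :=
  ⟨ψ, fun x => if x ∈ ψ.free then σ x else 0, k⟩

/-- Normalization of a single claim. -/
def normalizeClaim {n p : ℕ} : Claim n p → Program n p (List (EvalClaim n p))
  | .fieldEval ψ σ k => .pure [.mk' ψ σ k]
  | .boolEval ψ τ b => .pure [.mk' ψ (fun x => boolVal (ZMod p) (τ x)) (boolVal (ZMod p) b)]
  | .count ψ k => .pure [.mk' ψ (fun _ => 2⁻¹) ((k : ZMod p) * (2⁻¹) ^ ψ.free.card)]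
  | .equiv ψ₁ ψ₂ =>
      .sampleAssignment fun σ =>
      .ask (.evalAt ψ₁ σ) fun (a : ZMod p) =>
      .ask (.evalAt ψ₂ σ) fun (b : ZMod p) =>
      if a = b then .pure [.mk' ψ₁ σ a, .mk' ψ₂ σ b] else .reject
  | .nequiv ψ₁ ψ₂ =>
      .ask (.distinct ψ₁ ψ₂) fun (σ : Assignment n p) =>
      .ask (.evalAt ψ₁ σ) fun (a : ZMod p) =>
      .ask (.evalAt ψ₂ σ) fun (b : ZMod p) =>
      if a ≠ b then .pure [.mk' ψ₁ σ a, .mk' ψ₂ σ b] else .reject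

/-- Normalize: replace all claims, one after the other, by evaluation claims. -/
def normalizeClaims {n p : ℕ} : List (Claim n p) → Program n p (List (EvalClaim n p))
  | [] => .pure []
  | c :: cs =>
      (normalizeClaim c).bind fun C₁ =>
      (normalizeClaims cs).bind fun C₂ =>
      .pure (C₁ ++ C₂)

/-- Merge, body of the loop over the variables: for every claim `(σ, k)` about `ψ`, ask for the
polynomial in the variable `x`, and check its degree and its consistency with the claim. -/
def mergeAsk {n p : ℕ} (ψ : GBC n) (x : Fin n) :
    List (Assignment n p × ZMod p) → Program n p (List (Assignment n p × Polynomial (ZMod p)))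
  | [] => .pure []
  | (σ, k) :: C =>
      .ask (.evalExcept ψ (Function.update σ x 0) x) fun (q : Polynomial (ZMod p)) =>
      if q.natDegree ≤ 2 ∧ q.eval (σ x) = k then
        (mergeAsk ψ x C).bind fun C' => .pure ((σ, q) :: C')
      else .reject

/-- Merge, the loop over the variables: after all claims were asked, the variable receives one common
random value. -/
def mergeLoop {n p : ℕ} (ψ : GBC n) :
    List (Fin n) → List (Assignment n p × ZMod p) → Program n p (List (Assignment n p × ZMod p))
  | [], C => .pure C
  | x :: xs, C =>
      (mergeAsk ψ x C).bind fun C' =>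
      .sample fun r =>
      mergeLoop ψ xs (C'.map fun c => (Function.update c.1 x r, c.2.eval r)).dedup

/-- Merge: reduce the claims about `ψ` to a single one. A single claim is kept as it is. -/
def merge {n p : ℕ} (ψ : GBC n) :
    List (Assignment n p × ZMod p) → Program n p (Assignment n p × ZMod p)
  | [c] => .pure c
  | C =>
      (mergeLoop ψ ((List.finRange n).filter (· ∈ ψ.free)) C).bind fun C' =>
      match C' with
      | [c] => .pure c
      | _ => .reject

/-- Decision (at an input gate) and Propagate (at the other gates), for the principal claim that the
polynomial of the gate takes the value `k` at `σ`; returns the new claims about the successors. -/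
def propagate {n p : ℕ} (σ : Assignment n p) (k : ZMod p) :
    GBC n → Program n p (List (EvalClaim n p))
  | .top => if 1 = k then .pure [] else .reject
  | .bot => if 0 = k then .pure [] else .reject
  | .var x => if σ x = k then .pure [] else .reject
  | .neg ψ =>
      .ask (.evalAt ψ σ) fun (a : ZMod p) =>
      if 1 - a = k then .pure [.mk' ψ σ a] else .reject
  | .bin op ψ₁ ψ₂ =>
      .ask (.evalAt ψ₁ σ) fun (a : ZMod p) =>
      .ask (.evalAt ψ₂ σ) fun (b : ZMod p) =>
      if arithOp op a b = k then .pure [.mk' ψ₁ σ a, .mk' ψ₂ σ b] else .reject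
  | .proj x b ψ => .pure [.mk' ψ (Function.update σ x (boolVal (ZMod p) b)) k]
  | .ren y x ψ => .pure [.mk' ψ (Function.update σ x (σ y)) k]
  | .delta x ψ =>
      .ask (.evalExcept ψ (Function.update σ x 0) x) fun (q : Polynomial (ZMod p)) =>
      if q.natDegree ≤ 2 ∧ σ x * q.eval 1 + (1 - σ x) * q.eval 0 = k then
        .sample fun r => .pure [.mk' ψ (Function.update σ x r) (q.eval r)]
      else .reject

/-- CertifyAssignments: a round for every gate, in the given order. A gate about which there is no
claim is skipped. -/
def certifyAssignments {n p : ℕ} : List (GBC n) → List (EvalClaim n p) → Program n p Unit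
  | [], _ => .pure ()
  | ψ :: order, C =>
      match ((C.filter (·.gate = ψ)).map fun c => (c.asg, c.val)).dedup with
      | [] => certifyAssignments order C
      | Cψ =>
          (merge ψ Cψ).bind fun c =>
          (propagate c.1 c.2 ψ).bind fun C' =>
          certifyAssignments order (C ++ C')

/-- The whole protocol, for the gates in the given order and the given initial claims. -/
def certify {n p : ℕ} (order : List (GBC n)) (claims : List (Claim n p)) : Program n p Unit :=
  (normalizeClaims claims).bind (certifyAssignments order)

/-- The probability that Verifier accepts when interacting with `P`. -/
def acceptProb {n p : ℕ} [NeZero p] (P : Prover n p) (order : List (GBC n))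
    (claims : List (Claim n p)) : ENNReal :=
  (certify order claims).run P [] (some ())

end

/-!
The protocol is an interactive proof in the style of sum-check. Every gate of the degree-reduced
circuit has degree at most two in each variable, and the gates that stand for gates of the original
circuit have degree at most one (`degreeInLE_of_mem_reducedGates`, `degreeInLE_conv`). A gate of the
second kind therefore computes a multiaffine function over the field, which is determined by its
boolean values (`fn_eq_iff`), vanishes at a fraction of at most `n / p` of all points unless it is
zero (`IsMultiaffine.card_zeros_le`), and takes at the centre of the cube the average of its boolean
values (`IsMultiaffine.sum_boolVal`). Hence every claim is equivalent to its normal form, up to an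
error of `n / p` for an equivalence (`failLe_normalizeClaim`).

Soundness follows one false claim through the circuit. When Verifier replaces an entry by a random
field element, Prover has to commit to a polynomial of degree at most two that differs from the true
one, and the two agree at two points at most. So merging loses the falsehood with probability at most
`2 n / p` (`failLe_merge`), a degree reduction with probability at most `2 / p`, and the other gates
never (`failLe_propagate`). A gate inside a chain of degree reductions has the preceding
reduction as its only predecessor (`delta_parent_unique`), hence receives at most one claim and needs
no merging. A gate of the original circuit is thus charged `2 n / p` for one merge and `2 n / p` for
its at most `n` reductions (`sum_gateCost_le`), which gives `4 n |φ| / p` for the rounds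
(`failLe_certifyAssignments`).

The interaction is handled by two inductive predicates on programs. `Program.FailLe` bounds the error
against every Prover by counting bad random values along a path, so that transcripts and Prover's
randomness enter only in `Program.FailLe.run_le`; `Program.Succeeds` expresses acceptance with
certainty when the answers are truthful.
-/

open MvPolynomial

/-! ### Arithmetization -/

section Arithmetization

variable {n p : ℕ}

/-- Degree reduction interpolates linearly between the values at `x = 0` and `x = 1`. -/
theorem aeval_degreeReduce {A : Type*} [CommRing A] [Algebra (ZMod p) A] (g : Fin n → A)
    (x : Fin n) (q : MvPolynomial (Fin n) (ZMod p)) :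
    aeval g (degreeReduce x q) = g x * aeval (Function.update g x 1) q
      + (1 - g x) * aeval (Function.update g x 0) q := by
  have key : ∀ m : Fin n →₀ ℕ, ∏ i, g i ^ (m.update x (min (m x) 1)) i
      = g x * ∏ i, (Function.update g x 1 i) ^ m i
        + (1 - g x) * ∏ i, (Function.update g x 0 i) ^ m i := by
    intro m
    rw [← Finset.mul_prod_erase _ _ (Finset.mem_univ x),
      ← Finset.mul_prod_erase _ (fun i => Function.update g x 1 i ^ m i) (Finset.mem_univ x),
      ← Finset.mul_prod_erase _ (fun i => Function.update g x 0 i ^ m i) (Finset.mem_univ x)]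
    have e : ∀ h : Fin n → A, (∀ i, i ≠ x → h i = g i ^ m i) →
        ∏ i ∈ Finset.univ.erase x, h i = ∏ i ∈ Finset.univ.erase x, g i ^ m i := fun h hh =>
      Finset.prod_congr rfl fun i hi => hh i (Finset.ne_of_mem_erase hi)
    rw [e _ (fun i hi => by simp [Finsupp.update_apply, hi]),
      e (fun i => Function.update g x 1 i ^ m i) (fun i hi => by simp [hi]),
      e (fun i => Function.update g x 0 i ^ m i) (fun i hi => by simp [hi])]
    rcases Nat.eq_zero_or_pos (m x) with h0 | h0
    · simp [h0, Finsupp.update_apply]; ring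
    · simp [Finsupp.update_apply, Nat.min_eq_right h0, zero_pow h0.ne']
  rw [degreeReduce, map_sum, aeval_def, aeval_def, eval₂_eq', eval₂_eq', Finset.mul_sum,
    Finset.mul_sum, ← Finset.sum_add_distrib]
  refine Finset.sum_congr rfl fun m _ => ?_
  rw [aeval_monomial, Finsupp.prod_fintype _ _ (fun i => pow_zero _), key]
  ring

theorem map_boolVal {R S : Type*} [Ring R] [Ring S] (f : R →+* S) (b : Bool) :
    f (boolVal R b) = boolVal S b := by
  cases b <;> simp [boolVal]

theorem map_arithOp {R S : Type*} [Ring R] [Ring S] (f : R →+* S) (op : Bool → Bool → Bool)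
    (a b : R) : f (arithOp op a b) = arithOp op (f a) (f b) := by
  simp [arithOp, map_boolVal]

theorem arithOp_boolVal {R : Type*} [Ring R] (op : Bool → Bool → Bool) (a b : Bool) :
    arithOp op (boolVal R a) (boolVal R b) = boolVal R (op a b) := by
  cases a <;> cases b <;> simp [arithOp, boolVal]

@[simp]
theorem boolVal_true (R : Type*) [Ring R] : boolVal R true = 1 := rfl

@[simp]
theorem boolVal_false (R : Type*) [Ring R] : boolVal R false = 0 := rfl

theorem boolVal_injective (R : Type*) [Ring R] [Nontrivial R] :
    Function.Injective (boolVal R) := by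
  intro a b h
  cases a <;> cases b <;> simp_all [boolVal]

namespace GBC

variable {A : Type*} [CommRing A] [Algebra (ZMod p) A]

theorem aeval_arith_neg (g : Fin n → A) (φ : GBC n) :
    aeval g (arith p (neg φ)) = 1 - aeval g (φ.arith p) := by
  simp [arith]

theorem aeval_arith_bin (g : Fin n → A) (op : Bool → Bool → Bool) (φ ψ : GBC n) :
    aeval g (arith p (bin op φ ψ)) = arithOp op (aeval g (φ.arith p)) (aeval g (ψ.arith p)) :=
  map_arithOp (aeval g : MvPolynomial (Fin n) (ZMod p) →ₐ[ZMod p] A).toRingHom op _ _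

theorem aeval_arith_proj (g : Fin n → A) (x : Fin n) (b : Bool) (φ : GBC n) :
    aeval g (arith p (proj x b φ)) = aeval (Function.update g x (boolVal A b)) (φ.arith p) := by
  rw [arith, ← AlgHom.comp_apply, comp_aeval]
  congr 2
  funext z
  rcases eq_or_ne z x with rfl | h
  · simp [map_boolVal (algebraMap (ZMod p) A)]
  · simp [h]

theorem aeval_arith_ren (g : Fin n → A) (y x : Fin n) (φ : GBC n) :
    aeval g (arith p (ren y x φ)) = aeval (Function.update g x (g y)) (φ.arith p) := by
  rw [arith, aeval_rename]
  congr 2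
  funext z
  rcases eq_or_ne z x with rfl | h <;> simp [*]

theorem aeval_arith_delta (g : Fin n → A) (x : Fin n) (φ : GBC n) :
    aeval g (arith p (delta x φ)) = g x * aeval (Function.update g x 1) (φ.arith p)
      + (1 - g x) * aeval (Function.update g x 0) (φ.arith p) :=
  aeval_degreeReduce g x _

/-- The arithmetization of a gate depends on its free variables only. -/
theorem aeval_arith_congr (φ : GBC n) {g g' : Fin n → A} (h : ∀ x ∈ φ.free, g x = g' x) :
    aeval g (φ.arith p) = aeval g' (φ.arith p) := by
  induction φ generalizing g g' with
  | top => simp [arith]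
  | bot => simp [arith]
  | var x => simpa [arith] using h x (by simp [free])
  | neg φ ih => rw [aeval_arith_neg, aeval_arith_neg, ih h]
  | bin op φ ψ ih₁ ih₂ =>
    rw [aeval_arith_bin, aeval_arith_bin, ih₁ fun x hx => h x (by simp [free, hx]),
      ih₂ fun x hx => h x (by simp [free, hx])]
  | proj x b φ ih =>
    rw [aeval_arith_proj, aeval_arith_proj]
    refine ih fun z hz => ?_
    rcases eq_or_ne z x with rfl | hzx
    · simp
    · simpa [hzx] using h z (by simp [free, hz, hzx])
  | ren y x φ ih =>
    rw [aeval_arith_ren, aeval_arith_ren]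
    refine ih fun z hz => ?_
    rcases eq_or_ne z x with rfl | hzx
    · simpa using h y (Finset.mem_image.2 ⟨z, hz, by simp⟩)
    · simpa [hzx] using h z (Finset.mem_image.2 ⟨z, hz, by simp [hzx]⟩)
  | delta x φ ih =>
    have hu : ∀ a : A, aeval (Function.update g x a) (φ.arith p)
        = aeval (Function.update g' x a) (φ.arith p) := fun a => ih fun z hz => by
      rcases eq_or_ne z x with rfl | hzx
      · simp
      · simpa [hzx] using h z hz
    rw [aeval_arith_delta, aeval_arith_delta, hu, hu]
    by_cases hx : x ∈ φ.free
    · rw [h x hx]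
    · -- the two endpoint values coincide, so the interpolation parameter `g x` cancels
      have e : aeval (Function.update g' x 1) (φ.arith p)
          = aeval (Function.update g' x 0) (φ.arith p) := ih fun z hz => by
        have hzx : z ≠ x := fun e => hx (e ▸ hz)
        simp [hzx]
      rw [e]; ring

theorem eval_arith_congr (φ : GBC n) {σ σ' : Assignment n p} (h : ∀ x ∈ φ.free, σ x = σ' x) :
    eval σ (φ.arith p) = eval σ' (φ.arith p) := by
  simpa only [aeval_eq_eval] using aeval_arith_congr (p := p) φ h

theorem eval_arith_neg (σ : Assignment n p) (φ : GBC n) :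
    eval σ (arith p (neg φ)) = 1 - eval σ (φ.arith p) := by
  simpa only [aeval_eq_eval] using aeval_arith_neg (p := p) σ φ

theorem eval_arith_bin (σ : Assignment n p) (op : Bool → Bool → Bool) (φ ψ : GBC n) :
    eval σ (arith p (bin op φ ψ)) = arithOp op (eval σ (φ.arith p)) (eval σ (ψ.arith p)) := by
  simpa only [aeval_eq_eval] using aeval_arith_bin (p := p) σ op φ ψ

theorem eval_arith_proj (σ : Assignment n p) (x : Fin n) (b : Bool) (φ : GBC n) :
    eval σ (arith p (proj x b φ))
      = eval (Function.update σ x (boolVal (ZMod p) b)) (φ.arith p) := by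
  simpa only [aeval_eq_eval] using aeval_arith_proj (p := p) σ x b φ

theorem eval_arith_ren (σ : Assignment n p) (y x : Fin n) (φ : GBC n) :
    eval σ (arith p (ren y x φ)) = eval (Function.update σ x (σ y)) (φ.arith p) := by
  simpa only [aeval_eq_eval] using aeval_arith_ren (p := p) σ y x φ

theorem eval_arith_delta (σ : Assignment n p) (x : Fin n) (φ : GBC n) :
    eval σ (arith p (delta x φ)) = σ x * eval (Function.update σ x 1) (φ.arith p)
      + (1 - σ x) * eval (Function.update σ x 0) (φ.arith p) := by
  simpa only [aeval_eq_eval] using aeval_arith_delta (p := p) σ x φ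

/-- On boolean assignments the arithmetization computes the boolean function. -/
theorem eval_arith_boolVal (φ : GBC n) (τ : Fin n → Bool) :
    eval (fun x => boolVal (ZMod p) (τ x)) (φ.arith p) = boolVal (ZMod p) (φ.fn τ) := by
  have upd : ∀ (τ : Fin n → Bool) (x : Fin n) (b : Bool),
      Function.update (fun x => boolVal (ZMod p) (τ x)) x (boolVal (ZMod p) b)
        = fun z => boolVal (ZMod p) (Function.update τ x b z) := by
    intro τ x b
    funext z
    rcases eq_or_ne z x with rfl | h <;> simp [*]
  induction φ generalizing τ with
  | top => simp [arith, fn, boolVal]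
  | bot => simp [arith, fn, boolVal]
  | var x => simp [arith, fn]
  | neg φ ih => rw [eval_arith_neg, ih, fn]; cases φ.fn τ <;> simp [boolVal]
  | bin op φ ψ ih₁ ih₂ => rw [eval_arith_bin, ih₁, ih₂, arithOp_boolVal, fn]
  | proj x b φ ih => rw [eval_arith_proj, upd, ih, fn]
  | ren y x φ ih => rw [eval_arith_ren, upd, ih, fn]
  | delta x φ ih =>
    have h1 := ih (Function.update τ x true)
    have h0 := ih (Function.update τ x false)
    rw [← upd] at h1 h0
    rw [boolVal_true] at h1
    rw [boolVal_false] at h0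
    rw [eval_arith_delta, fn, h1, h0]
    cases hx : τ x
    · rw [← hx, Function.update_eq_self, hx]; simp
    · rw [← hx, Function.update_eq_self, hx]; simp

end GBC

/-! ### Restrictions to one variable -/

theorem evalExcept_update (σ : Assignment n p) (x : Fin n) (a : ZMod p)
    (q : MvPolynomial (Fin n) (ZMod p)) :
    evalExcept (Function.update σ x a) x q = evalExcept σ x q := by
  unfold evalExcept
  congr 2
  funext z
  rcases eq_or_ne z x with rfl | h <;> simp [*]

theorem eval_evalExcept (σ : Assignment n p) (x : Fin n) (a : ZMod p)
    (q : MvPolynomial (Fin n) (ZMod p)) :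
    (evalExcept σ x q).eval a = eval (Function.update σ x a) q := by
  have : (Polynomial.aeval a).comp
      (aeval (fun z => if z = x then Polynomial.X else Polynomial.C (σ z)))
      = aeval (R := ZMod p) (Function.update σ x a) := by
    rw [comp_aeval]
    congr 1
    funext z
    rcases eq_or_ne z x with rfl | h <;> simp [*]
  rw [← aeval_eq_eval, ← this]
  simp [evalExcept, Polynomial.coe_aeval_eq_eval]

/-- If all coordinates are constants then the value is a constant. -/
theorem natDegree_aeval_C (σ : Assignment n p) (q : MvPolynomial (Fin n) (ZMod p)) :
    (aeval (fun z => Polynomial.C (σ z)) q : Polynomial (ZMod p)).natDegree = 0 := by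
  have : (aeval (fun z => Polynomial.C (σ z)) q : Polynomial (ZMod p))
      = Polynomial.C (eval σ q) := by
    rw [← aeval_eq_eval]
    have := aeval_algebraMap_apply (R := ZMod p) (Polynomial (ZMod p)) σ q
    simpa [Polynomial.algebraMap_eq, Function.comp_def] using this
  rw [this, Polynomial.natDegree_C]

/-- `DegreeInLE ψ x d`: restricting all variables but `x` to constants turns the arithmetization of
`ψ` into a polynomial of degree at most `d`. -/
def DegreeInLE (p : ℕ) (ψ : GBC n) (x : Fin n) (d : ℕ) : Prop :=
  ∀ σ : Assignment n p, (evalExcept σ x (ψ.arith p)).natDegree ≤ d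

open Polynomial in
theorem natDegree_arithOp_le {R : Type*} [CommRing R] (op : Bool → Bool → Bool) {f g : R[X]}
    {d e : ℕ} (hf : f.natDegree ≤ d) (hg : g.natDegree ≤ e) :
    (arithOp op f g).natDegree ≤ d + e := by
  have b : ∀ b, (boolVal R[X] b).natDegree = 0 := fun b => by cases b <;> simp [boolVal]
  have hf' : (1 - f).natDegree ≤ d := (natDegree_sub_le _ _).trans (by simpa using hf)
  have hg' : (1 - g).natDegree ≤ e := (natDegree_sub_le _ _).trans (by simpa using hg)
  have m : ∀ {u v : R[X]} (c : Bool), u.natDegree ≤ d → v.natDegree ≤ e →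
      (boolVal R[X] c * (u * v)).natDegree ≤ d + e := fun c hu hv =>
    natDegree_mul_le.trans (by rw [b, zero_add]; exact natDegree_mul_le_of_le hu hv)
  unfold arithOp
  exact natDegree_add_le_of_degree_le (natDegree_add_le_of_degree_le (natDegree_add_le_of_degree_le
    (m _ hf' hg') (m _ hf' hg)) (m _ hf hg')) (m _ hf hg)

theorem DegreeInLE.bin {ψ₁ ψ₂ : GBC n} {x : Fin n} {d e : ℕ} (h₁ : DegreeInLE p ψ₁ x d)
    (h₂ : DegreeInLE p ψ₂ x e) (op : Bool → Bool → Bool) :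
    DegreeInLE p (.bin op ψ₁ ψ₂) x (d + e) := fun σ => by
  rw [evalExcept, GBC.aeval_arith_bin]
  exact natDegree_arithOp_le op (h₁ σ) (h₂ σ)

theorem DegreeInLE.neg {ψ : GBC n} {x : Fin n} {d : ℕ} (h : DegreeInLE p ψ x d) :
    DegreeInLE p (.neg ψ) x d := fun σ => by
  rw [evalExcept, GBC.aeval_arith_neg]
  exact (Polynomial.natDegree_sub_le _ _).trans (max_le (by simp) (h σ))

/-- Substituting a constant for another variable commutes with restricting to `x`. -/
theorem update_restrict (σ : Assignment n p) {x z : Fin n} (h : z ≠ x) (a : ZMod p) :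
    Function.update (fun w => if w = z then Polynomial.X else Polynomial.C (σ w)) x
        (Polynomial.C a)
      = fun w => if w = z then Polynomial.X else Polynomial.C (Function.update σ x a w) := by
  funext w
  rcases eq_or_ne w x with rfl | hw
  · simp [h.symm]
  · simp [hw]

/-- Substituting a constant for the unassigned variable leaves only constants. -/
theorem update_restrict_self (σ : Assignment n p) (x : Fin n) (a : ZMod p) :
    Function.update (fun w => if w = x then Polynomial.X else Polynomial.C (σ w)) x
        (Polynomial.C a)
      = fun w => Polynomial.C (Function.update σ x a w) := by
  funext w
  rcases eq_or_ne w x with rfl | hw <;> simp [*]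

theorem DegreeInLE.proj {ψ : GBC n} {z : Fin n} {d : ℕ} (h : DegreeInLE p ψ z d) (x : Fin n)
    (b : Bool) : DegreeInLE p (.proj x b ψ) z d := fun σ => by
  rw [evalExcept, GBC.aeval_arith_proj, ← map_boolVal (Polynomial.C (R := ZMod p))]
  rcases eq_or_ne z x with rfl | hz
  · rw [update_restrict_self, natDegree_aeval_C]
    exact Nat.zero_le d
  · rw [update_restrict _ hz]
    exact h _

theorem DegreeInLE.delta {ψ : GBC n} {z : Fin n} {d : ℕ} (h : DegreeInLE p ψ z d) (x : Fin n)
    (hzx : z ≠ x) : DegreeInLE p (.delta x ψ) z d := fun σ => by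
  rw [evalExcept, GBC.aeval_arith_delta, ← map_one Polynomial.C, ← map_zero Polynomial.C,
    update_restrict _ hzx, update_restrict _ hzx, if_neg hzx.symm, ← map_sub]
  refine Polynomial.natDegree_add_le_of_degree_le ?_ ?_
  · exact (Polynomial.natDegree_C_mul_le _ _).trans (h _)
  · exact (Polynomial.natDegree_C_mul_le _ _).trans (h _)

theorem degreeInLE_delta_self (ψ : GBC n) (x : Fin n) : DegreeInLE p (.delta x ψ) x 1 :=
    fun σ => by
  rw [evalExcept, GBC.aeval_arith_delta, if_pos rfl]
  have h1 : (1 - Polynomial.X : Polynomial (ZMod p)).natDegree ≤ 1 :=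
    (Polynomial.natDegree_sub_le _ _).trans (by simpa using Polynomial.natDegree_X_le)
  have c : ∀ a : ZMod p, (aeval (Function.update (fun w => if w = x then Polynomial.X else
      Polynomial.C (σ w)) x (Polynomial.C a)) (ψ.arith p)).natDegree ≤ 0 := fun a => by
    rw [update_restrict_self, natDegree_aeval_C]
  have c1 := c 1
  have c0 := c 0
  rw [map_one] at c1
  rw [map_zero] at c0
  exact Polynomial.natDegree_add_le_of_degree_le
    (Polynomial.natDegree_mul_le_of_le Polynomial.natDegree_X_le c1)
    (Polynomial.natDegree_mul_le_of_le h1 c0)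

theorem DegreeInLE.ren {ψ : GBC n} {d : ℕ} (h : ∀ z, DegreeInLE p ψ z d) {y : Fin n} (x z : Fin n)
    (hy : y ∉ ψ.free) : DegreeInLE p (.ren y x ψ) z d := fun σ => by
  rw [evalExcept, GBC.aeval_arith_ren]
  rcases eq_or_ne y z with rfl | hyz
  · -- `x` takes over the role of `y`, which does not occur in `ψ`
    rw [if_pos rfl]
    refine le_of_eq_of_le ?_ (h x σ)
    rw [evalExcept, GBC.aeval_arith_congr ψ]
    intro w hw
    have hwy : w ≠ y := fun e => hy (e ▸ hw)
    rcases eq_or_ne w x with rfl | hwx <;> simp [*]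
  · rw [if_neg hyz]
    rcases eq_or_ne z x with rfl | hzx
    · rw [update_restrict_self, natDegree_aeval_C]
      exact Nat.zero_le d
    · rw [update_restrict _ hzx]
      exact h z _

/-- A chain of degree reductions has degree at most one in the variables it treats, and does not
raise the degree in the others. -/
theorem degreeInLE_foldr_delta {ψ : GBC n} (l : List (Fin n)) {z : Fin n} {d : ℕ}
    (h : z ∉ l → DegreeInLE p ψ z d) (hd : 1 ≤ d) : DegreeInLE p (l.foldr .delta ψ) z d := by
  induction l with
  | nil => exact h (by simp)
  | cons x l ih =>
    rcases eq_or_ne z x with rfl | hzx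
    · exact fun σ => (degreeInLE_delta_self _ _ σ).trans hd
    · exact (ih fun hz => h (by simp [hzx, hz])).delta x hzx

theorem GBC.free_foldr_delta (l : List (Fin n)) (ψ : GBC n) :
    (l.foldr delta ψ).free = ψ.free := by
  induction l with
  | nil => rfl
  | cons x l ih => simpa [free] using ih

theorem GBC.free_conv (ψ : GBC n) : ψ.conv.free = ψ.free := by
  induction ψ with
  | bin op φ ψ ih₁ ih₂ => rw [conv, reduceAll, free_foldr_delta]; simp [free, ih₁, ih₂]
  | _ => simp_all [conv, free]

/-- The gates of a degree-reduced circuit that stand for gates of the original circuit have degree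
at most one in every variable. -/
theorem degreeInLE_conv {ψ : GBC n} (hψ : ψ.IsExpr) (z : Fin n) : DegreeInLE p ψ.conv z 1 := by
  induction ψ generalizing z with
  | top => intro σ; simp [evalExcept, GBC.conv, GBC.arith]
  | bot => intro σ; simp [evalExcept, GBC.conv, GBC.arith]
  | var x =>
    intro σ
    rw [GBC.conv, GBC.arith, evalExcept, aeval_X]
    split_ifs
    · exact Polynomial.natDegree_X_le
    · simp
  | neg φ ih => exact (ih hψ z).neg
  | bin op φ ψ ih₁ ih₂ =>
    exact degreeInLE_foldr_delta _ (fun h => absurd (List.mem_finRange z) h) le_rfl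
  | proj x b φ ih => exact (ih hψ z).proj x b
  | ren y x φ ih =>
    exact DegreeInLE.ren (fun z => ih hψ.1 z) x z (by rw [GBC.free_conv]; exact hψ.2)
  | delta x φ ih => exact hψ.elim

end Arithmetization

/-! ### Multiaffine functions -/

section Multiaffine

variable {ι R : Type*} [DecidableEq ι] [CommRing R]

/-- A function that is affine in each variable separately. -/
def IsMultiaffine (F : (ι → R) → R) : Prop :=
  ∀ σ x, F σ = σ x * F (Function.update σ x 1) + (1 - σ x) * F (Function.update σ x 0)

theorem IsMultiaffine.sub {F G : (ι → R) → R} (hF : IsMultiaffine F) (hG : IsMultiaffine G) :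
    IsMultiaffine fun σ => F σ - G σ := fun σ x => by
  simp only
  rw [hF σ x, hG σ x]
  ring

/-- A multiaffine function that vanishes at all boolean points vanishes everywhere. -/
theorem IsMultiaffine.eq_zero [Fintype ι] {F : (ι → R) → R} (hF : IsMultiaffine F)
    (h : ∀ τ : ι → Bool, F (fun i => boolVal R (τ i)) = 0) (σ : ι → R) : F σ = 0 := by
  have key : ∀ s : Finset ι, ∀ σ : ι → R, (∀ i ∉ s, ∃ b, σ i = boolVal R b) → F σ = 0 := by
    intro s
    induction s using Finset.induction_on with
    | empty =>
      intro σ hσ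
      choose τ hτ using fun i => hσ i (by simp)
      rw [funext hτ]
      exact h τ
    | insert a s _ ih =>
      intro σ hσ
      have : ∀ b, F (Function.update σ a (boolVal R b)) = 0 := fun b => ih _ fun i hi => by
        rcases eq_or_ne i a with rfl | hia
        · exact ⟨b, by simp⟩
        · simpa [hia] using hσ i (by simp [hia, hi])
      have h1 := this true
      have h0 := this false
      rw [boolVal_true] at h1
      rw [boolVal_false] at h0
      rw [hF σ a, h1, h0]
      simp
  exact key Finset.univ σ (by simp)

/-- The value of a multiaffine function at the centre of the cube is the average of its values at
the vertices. -/
theorem IsMultiaffine.sum_boolVal [Fintype ι] {F : (ι → R) → R} (hF : IsMultiaffine F) {c : R}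
    (hc : 2 * c = 1) :
    ∑ τ : ι → Bool, F (fun i => boolVal R (τ i)) = 2 ^ Fintype.card ι * F (fun _ => c) := by
  -- move the coordinates to the centre one after the other
  have key : ∀ s : Finset ι,
      ∑ τ : ι → Bool, F (fun i => if i ∈ s then c else boolVal R (τ i))
        = ∑ τ : ι → Bool, F (fun i => boolVal R (τ i)) := by
    intro s
    induction s using Finset.induction_on with
    | empty => simp
    | insert a s ha ih =>
      rw [← ih]
      set H : (ι → Bool) → R := fun τ => F (fun i => if i ∈ s then c else boolVal R (τ i)) with hH
      set flip : (ι → Bool) → (ι → Bool) := fun τ => Function.update τ a (!τ a) with hflip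
      have hinv : Function.Involutive flip := fun τ => by
        funext i
        rcases eq_or_ne i a with rfl | hia <;> simp [*]
      have hstep : ∀ τ : ι → Bool,
          F (fun i => if i ∈ insert a s then c else boolVal R (τ i)) = c * (H τ + H (flip τ)) := by
        intro τ
        have hu : ∀ b : Bool, Function.update
            (fun i => if i ∈ insert a s then c else boolVal R (τ i)) a (boolVal R b)
            = fun i => if i ∈ s then c else boolVal R (Function.update τ a b i) := fun b => by
          funext i
          rcases eq_or_ne i a with rfl | hia
          · simp [ha]
          · simp [hia]
        have h1 := hu true
        have h0 := hu false
        have hself : H τ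
            = F (fun i => if i ∈ s then c else boolVal R (Function.update τ a (τ a) i)) := by
          simp [hH]
        rw [hF _ a]
        rw [boolVal_true] at h1
        rw [boolVal_false] at h0
        rw [h1, h0, hself]
        have hc' : 1 - c = c := by linear_combination -hc
        simp only [Finset.mem_insert_self, if_true, hc', hH, hflip]
        cases τ a
        · simp; ring
        · simp; ring
      rw [Finset.sum_congr rfl fun τ _ => hstep τ, ← Finset.mul_sum, Finset.sum_add_distrib,
        show ∑ τ, H (flip τ) = ∑ τ, H τ from Equiv.sum_comp hinv.toPerm H]
      linear_combination (∑ τ, H τ) * hc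
  rw [← key Finset.univ]
  simp

/-- The Schwartz–Zippel bound for multiaffine functions over a finite field: a function that is not
identically zero vanishes at a fraction of at most `card ι / card R` of all points. -/
theorem IsMultiaffine.card_zeros_le [Fintype ι] [IsDomain R] [Fintype R] [DecidableEq R]
    {F : (ι → R) → R} (hF : IsMultiaffine F) {σ₀ : ι → R} (h₀ : F σ₀ ≠ 0) :
    (Finset.univ.filter fun σ => F σ = 0).card * Fintype.card R
      ≤ Fintype.card ι * Fintype.card R ^ Fintype.card ι := by
  -- randomize the coordinates of `σ₀` one after the other
  have key : ∀ s : Finset ι,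
      (Finset.univ.filter fun σ : ι → R => F (fun i => if i ∈ s then σ i else σ₀ i) = 0).card
        * Fintype.card R ≤ s.card * Fintype.card R ^ Fintype.card ι := by
    intro s
    induction s using Finset.induction_on with
    | empty => simp [h₀]
    | insert a s ha ih =>
      set H : (ι → R) → R := fun σ => F (fun i => if i ∈ s then σ i else σ₀ i) with hH
      set H' : (ι → R) → R := fun σ => F (fun i => if i ∈ insert a s then σ i else σ₀ i) with hH'
      set B := Finset.univ.filter fun σ : ι → R => H σ ≠ 0 ∧ H' σ = 0 with hB
      have hsub : (Finset.univ.filter fun σ => H' σ = 0)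
          ⊆ (Finset.univ.filter fun σ => H σ = 0) ∪ B := by
        intro σ hσ
        simp only [Finset.mem_filter, Finset.mem_univ, true_and, Finset.mem_union, hB] at hσ ⊢
        tauto
      have hinj : B.card * Fintype.card R ≤ Fintype.card R ^ Fintype.card ι := by
        rw [← Fintype.card_fun, ← Finset.card_univ, ← Finset.card_univ, ← Finset.card_product]
        refine Finset.card_le_card_of_injOn (fun q => Function.update q.1 a q.2)
          (fun _ _ => Finset.mem_coe.2 (Finset.mem_univ _)) ?_
        rintro ⟨σ, t⟩ hσ ⟨σ', t'⟩ hσ' he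
        simp only [Finset.coe_product, Set.mem_prod, Finset.mem_coe, hB, Finset.mem_filter,
          Finset.mem_univ, true_and, and_true] at hσ hσ'
        simp only at he
        have ht : t = t' := by simpa using congrFun he a
        have hoff : ∀ i, i ≠ a → σ i = σ' i := fun i hi => by simpa [hi] using congrFun he i
        -- along the `a`-axis the function is affine and not zero, so it has at most one zero
        set g : ι → R := fun i => if i ∈ s then σ i else σ₀ i with hg
        have e1 : ∀ ρ : ι → R, (∀ i, i ≠ a → ρ i = σ i) → H' ρ
            = ρ a * F (Function.update g a 1) + (1 - ρ a) * F (Function.update g a 0) := by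
          intro ρ hρ
          have : ∀ c : R, Function.update (fun i => if i ∈ insert a s then ρ i else σ₀ i) a c
              = Function.update g a c := fun c => by
            funext i
            rcases eq_or_ne i a with rfl | hia
            · simp
            · simp [hia, hg, hρ i hia]
          simp only [hH']
          rw [hF _ a, this, this]
          simp
        have e2 := e1 σ fun _ _ => rfl
        have e3 := e1 σ' fun i hi => (hoff i hi).symm
        have e4 : H σ = σ₀ a * F (Function.update g a 1)
            + (1 - σ₀ a) * F (Function.update g a 0) := by
          have : g a = σ₀ a := by simp [hg, ha]
          rw [← this]
          exact hF g a
        have hprod : (σ a - σ' a) * (F (Function.update g a 1) - F (Function.update g a 0)) = 0 := by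
          linear_combination e3 - e2 + hσ.2 - hσ'.2
        have hσa : σ a = σ' a := by
          rcases mul_eq_zero.1 hprod with h | h
          · exact sub_eq_zero.1 h
          · exact absurd (by linear_combination e4 - e2 + hσ.2 + (σ₀ a - σ a) * h) hσ.1
        have : σ = σ' := funext fun i => by
          by_cases hi : i = a
          · rw [hi, hσa]
          · exact hoff i hi
        rw [this, ht]
      calc _ ≤ ((Finset.univ.filter fun σ => H σ = 0).card + B.card) * Fintype.card R :=
            Nat.mul_le_mul_right _ ((Finset.card_le_card hsub).trans (Finset.card_union_le _ _))
        _ ≤ s.card * Fintype.card R ^ Fintype.card ι + Fintype.card R ^ Fintype.card ι := by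
            rw [add_mul]; exact Nat.add_le_add ih hinj
        _ = _ := by rw [Finset.card_insert_of_notMem ha]; ring
  simpa using key Finset.univ

end Multiaffine

/-! ### Error bounds for programs -/

namespace Program

variable {n p : ℕ} {α β : Type}

/-- `FailLe Q prog k`: whatever the answers of Prover, the probability that `prog` returns a result
violating `Q` is at most `k / p`. Rejecting does not count as a failure. The number `k` adds up the
errors of the random draws along a path, where a draw that goes wrong with probability at most
`m / p` counts `m`. -/
inductive FailLe [NeZero p] (Q : α → Prop) : Program n p α → ℕ → Prop
  | pure {a : α} {k : ℕ} (h : Q a) : FailLe Q (pure a) k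
  | reject {k : ℕ} : FailLe Q reject k
  | ask {c : Challenge n p} {next : c.Answer → Program n p α} {k : ℕ}
      (h : ∀ a, FailLe Q (next a) k) : FailLe Q (ask c next) k
  | sample {next : ZMod p → Program n p α} {k m : ℕ} (bad : Finset (ZMod p)) (hm : bad.card ≤ m)
      (h : ∀ r ∉ bad, FailLe Q (next r) k) : FailLe Q (sample next) (m + k)
  | sampleAssignment {next : Assignment n p → Program n p α} {k m : ℕ}
      (bad : Finset (Assignment n p)) (hm : bad.card * p ≤ m * p ^ n)
      (h : ∀ σ ∉ bad, FailLe Q (next σ) k) : FailLe Q (sampleAssignment next) (m + k)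

/-- `Succeeds Q prog`: against truthful answers, `prog` never rejects, and its results satisfy
`Q`. -/
inductive Succeeds (Q : α → Prop) : Program n p α → Prop
  | pure {a : α} (h : Q a) : Succeeds Q (pure a)
  | ask {c : Challenge n p} {next : c.Answer → Program n p α}
      (h : ∀ a, c.IsTruthful a → Succeeds Q (next a)) : Succeeds Q (ask c next)
  | sample {next : ZMod p → Program n p α} (h : ∀ r, Succeeds Q (next r)) :
      Succeeds Q (sample next)
  | sampleAssignment {next : Assignment n p → Program n p α} (h : ∀ σ, Succeeds Q (next σ)) :
      Succeeds Q (sampleAssignment next)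

theorem Succeeds.bind {Q : α → Prop} {R : β → Prop} {m : Program n p α}
    {f : α → Program n p β} (hm : Succeeds Q m) (hf : ∀ a, Q a → Succeeds R (f a)) :
    Succeeds R (m.bind f) := by
  induction hm with
  | pure h => exact hf _ h
  | ask _ ih => exact .ask ih
  | sample _ ih => exact .sample ih
  | sampleAssignment _ ih => exact .sampleAssignment ih

section FailLe

variable [NeZero p]

theorem FailLe.mono {Q R : α → Prop} {m : Program n p α} {k l : ℕ} (hm : FailLe Q m k)
    (h : ∀ a, Q a → R a) (hkl : k ≤ l) : FailLe R m l := by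
  induction hm generalizing l with
  | pure h' => exact .pure (h _ h')
  | reject => exact .reject
  | ask _ ih => exact .ask fun a => ih a hkl
  | @sample _ k m bad hm _ ih =>
    obtain ⟨d, rfl⟩ := Nat.exists_eq_add_of_le hkl
    rw [add_assoc]
    exact .sample bad hm fun r hr => ih r hr (Nat.le_add_right k d)
  | @sampleAssignment _ k m bad hm _ ih =>
    obtain ⟨d, rfl⟩ := Nat.exists_eq_add_of_le hkl
    rw [add_assoc]
    exact .sampleAssignment bad hm fun r hr => ih r hr (Nat.le_add_right k d)

/-- Union bound: the errors of consecutive programs add up. -/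
theorem FailLe.bind {Q : α → Prop} {R : β → Prop} {m : Program n p α}
    {f : α → Program n p β} {k l : ℕ} (hm : FailLe Q m k) (hf : ∀ a, Q a → FailLe R (f a) l) :
    FailLe R (m.bind f) (k + l) := by
  induction hm with
  | pure h => exact (hf _ h).mono (fun _ h => h) (Nat.le_add_left _ _)
  | reject => exact .reject
  | ask _ ih => exact .ask ih
  | sample bad hm _ ih => rw [add_assoc]; exact .sample bad hm ih
  | sampleAssignment bad hm _ ih => rw [add_assoc]; exact .sampleAssignment bad hm ih

end FailLe

/-- If all but a small set of outcomes of a uniform draw lead to an event with probability at most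
`c`, then the event has probability at most `b + c`, where `b` is the probability of the set. -/
theorem uniform_bind_apply_le {γ δ : Type} [Fintype γ] [Nonempty γ] (f : γ → PMF δ) (d : δ)
    (bad : Finset γ) (c : ENNReal) (h : ∀ x ∉ bad, f x d ≤ c) :
    ((PMF.uniformOfFintype γ).bind f) d ≤ bad.card / Fintype.card γ + c := by
  classical
  rw [PMF.bind_apply, tsum_fintype]
  have hle : ∀ x, PMF.uniformOfFintype γ x * f x d
      ≤ (if x ∈ bad then (Fintype.card γ : ENNReal)⁻¹ else 0)
        + PMF.uniformOfFintype γ x * c := by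
    intro x
    split_ifs with hx
    · refine le_trans ?_ (le_add_of_nonneg_right (zero_le))
      rw [PMF.uniformOfFintype_apply]
      exact mul_le_of_le_one_right' (PMF.coe_le_one _ _)
    · rw [zero_add]
      gcongr
      exact h x hx
  have hone : ∑ x, PMF.uniformOfFintype γ x = 1 := by
    rw [← tsum_fintype (L := .unconditional γ)]
    exact PMF.tsum_coe _
  refine (Finset.sum_le_sum fun x _ => hle x).trans (le_of_eq ?_)
  rw [Finset.sum_add_distrib, ← Finset.sum_mul, hone, one_mul, Finset.sum_ite_mem,
    Finset.univ_inter, Finset.sum_const, nsmul_eq_mul, div_eq_mul_inv]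

/-- A program whose results are never acceptable returns a result with probability at most the
recorded error. -/
theorem FailLe.run_le [NeZero p] {m : Program n p α} {k : ℕ} (hm : FailLe (fun _ => False) m k)
    (P : Prover n p) (h : Transcript n p) (a : α) : m.run P h (some a) ≤ (k : ENNReal) / p := by
  induction hm generalizing h with
  | pure h' => exact h'.elim
  | reject => simp [run]
  | @ask c next k _ ih =>
    rw [run, PMF.bind_apply]
    calc _ ≤ ∑' x, P h c x * ((k : ENNReal) / p) := by
          refine ENNReal.tsum_le_tsum fun x => ?_
          gcongr
          exact ih x _
      _ = _ := by rw [ENNReal.tsum_mul_right, PMF.tsum_coe, one_mul]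
  | @sample next k m bad hm _ ih =>
    rw [run]
    refine (uniform_bind_apply_le _ _ bad _ fun r hr => ih r hr h).trans ?_
    rw [ZMod.card, Nat.cast_add, ENNReal.add_div]
    gcongr
  | @sampleAssignment next k m bad hm _ ih =>
    rw [run]
    refine (uniform_bind_apply_le _ _ bad _ fun r hr => ih r hr h).trans ?_
    rw [Nat.cast_add, ENNReal.add_div]
    gcongr ?_ + _
    have hp : (p : ENNReal) ≠ 0 := by exact_mod_cast NeZero.ne p
    rw [Fintype.card_fun, ZMod.card, Fintype.card_fin, Nat.cast_pow,
      ENNReal.div_le_iff (pow_ne_zero _ hp) (by finiteness), ENNReal.mul_comm_div,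
      ← mul_div_assoc, ENNReal.le_div_iff_mul_le (Or.inl hp) (Or.inl (by finiteness))]
    exact_mod_cast hm

/-- A program without result that succeeds against truthful answers accepts with certainty when
interacting with an honest Prover. -/
theorem Succeeds.run_eq_one [NeZero p] {Q : Unit → Prop} {m : Program n p Unit}
    (hm : Succeeds Q m) {P : Prover n p} (hP : P.Honest) (h : Transcript n p) :
    m.run P h (some ()) = 1 := by
  have bind_eq_one : ∀ {γ : Type} (q : PMF γ) (f : γ → PMF (Option Unit)),
      (∀ x ∈ q.support, f x (some ()) = 1) → q.bind f (some ()) = 1 := by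
    intro γ q f hf
    rw [PMF.bind_apply, ← q.tsum_coe]
    refine tsum_congr fun x => ?_
    by_cases hx : x ∈ q.support
    · rw [hf x hx, mul_one]
    · rw [(PMF.apply_eq_zero_iff _ _).2 hx, zero_mul]
  induction hm generalizing h with
  | pure _ => simp [run]
  | ask _ ih => exact bind_eq_one _ _ fun a ha => ih a (hP _ _ a ha) _
  | sample _ ih => exact bind_eq_one _ _ fun r _ => ih r h
  | sampleAssignment _ ih => exact bind_eq_one _ _ fun σ _ => ih σ h

end Program

/-- A Prover that is not computationally bounded can answer every challenge truthfully. -/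
theorem Prover.exists_honest (n p : ℕ) : ∃ P : Prover n p, P.Honest := by
  have h : ∀ c : Challenge n p, ∃ a : c.Answer, c.IsTruthful a := by
    rintro (⟨ψ, σ⟩ | ⟨ψ, σ, x⟩ | ⟨ψ₁, ψ₂⟩)
    · exact ⟨_, rfl⟩
    · exact ⟨_, rfl⟩
    · by_cases hex : ∃ σ, MvPolynomial.eval σ (ψ₁.arith p) ≠ MvPolynomial.eval σ (ψ₂.arith p)
      · exact ⟨hex.choose, fun _ => hex.choose_spec⟩
      · exact ⟨fun _ => 0, fun h => absurd h hex⟩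
  choose ans hans using h
  refine ⟨fun _ c => PMF.pure (ans c), fun _ c a ha => ?_⟩
  rw [PMF.support_pure, Set.mem_singleton_iff] at ha
  exact ha ▸ hans c

/-! ### The gates of a degree-reduced circuit -/

namespace GBC

variable {n : ℕ}

theorem self_mem_subexprs (ψ : GBC n) : ψ ∈ ψ.subexprs := by
  cases ψ <;> simp [subexprs]

theorem subexprs_subset {ψ χ : GBC n} (h : ψ ∈ χ.subexprs) : ψ.subexprs ⊆ χ.subexprs := by
  induction χ with
  | top | bot | var x => simp only [subexprs, Finset.mem_singleton] at h; rw [h]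
  | bin op φ φ' ih₁ ih₂ =>
    simp only [subexprs, Finset.mem_insert, Finset.mem_union] at h
    rcases h with rfl | h | h
    · rfl
    · exact (ih₁ h).trans fun z hz => by simp [subexprs, hz]
    · exact (ih₂ h).trans fun z hz => by simp [subexprs, hz]
  | neg φ ih | proj x b φ ih | ren y x φ ih | delta x φ ih =>
    simp only [subexprs, Finset.mem_insert] at h
    rcases h with rfl | h
    · rfl
    · exact (ih h).trans (Finset.subset_insert _ _)

theorem children_subset_subexprs (ψ : GBC n) : ψ.children ⊆ ψ.subexprs := by
  cases ψ <;> simp [children, subexprs, Finset.insert_subset_iff, self_mem_subexprs]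

theorem IsExpr.of_mem_subexprs {ψ χ : GBC n} (hχ : χ.IsExpr) (h : ψ ∈ χ.subexprs) :
    ψ.IsExpr := by
  induction χ with
  | top | bot | var x => simp only [subexprs, Finset.mem_singleton] at h; rw [h]; exact hχ
  | bin op φ φ' ih₁ ih₂ =>
    simp only [subexprs, Finset.mem_insert, Finset.mem_union] at h
    rcases h with rfl | h | h
    · exact hχ
    · exact ih₁ hχ.1 h
    · exact ih₂ hχ.2 h
  | neg φ ih | proj x b φ ih =>
    simp only [subexprs, Finset.mem_insert] at h
    rcases h with rfl | h
    · exact hχ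
    · exact ih hχ h
  | ren y x φ ih =>
    simp only [subexprs, Finset.mem_insert] at h
    rcases h with rfl | h
    · exact hχ
    · exact ih hχ.1 h
  | delta x φ ih => exact hχ.elim

theorem notMem_children_self (ψ : GBC n) : ψ ∉ ψ.children := by
  intro h
  have : ∀ χ ∈ ψ.children, sizeOf χ < sizeOf ψ := by
    cases ψ <;> simp [children]
    omega
  exact lt_irrefl _ (this ψ h)

/-- The gate below the first `i` reductions in the chain that `conv` builds for the gate `φ op ψ`;
for `i ≥ n` this is the binary gate itself. -/
def chain (op : Bool → Bool → Bool) (φ ψ : GBC n) (i : ℕ) : GBC n :=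
  ((List.finRange n).drop i).foldr delta (bin op φ.conv ψ.conv)

theorem chain_of_lt (op : Bool → Bool → Bool) (φ ψ : GBC n) {i : ℕ} (hi : i < n) :
    chain op φ ψ i = delta ⟨i, hi⟩ (chain op φ ψ (i + 1)) := by
  rw [chain, List.drop_eq_getElem_cons (by simpa using hi)]
  simp [chain]

theorem chain_of_le (op : Bool → Bool → Bool) (φ ψ : GBC n) {i : ℕ} (hi : n ≤ i) :
    chain op φ ψ i = bin op φ.conv ψ.conv := by
  rw [chain, List.drop_eq_nil_of_le (by simpa using hi)]
  rfl

theorem mem_subexprs_foldr_delta {l : List (Fin n)} {ψ χ : GBC n}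
    (h : χ ∈ (l.foldr delta ψ).subexprs) :
    χ ∈ ψ.subexprs ∨ ∃ i, χ = (l.drop i).foldr delta ψ := by
  induction l with
  | nil => exact Or.inl h
  | cons x l ih =>
    simp only [List.foldr_cons, subexprs, Finset.mem_insert] at h
    rcases h with rfl | h
    · exact Or.inr ⟨0, rfl⟩
    · rcases ih h with h | ⟨i, h⟩
      · exact Or.inl h
      · exact Or.inr ⟨i + 1, by simpa using h⟩

/-- Every gate of `conv χ` stands for a gate of `χ` or belongs to a chain of degree reductions. -/
theorem mem_subexprs_conv {χ ψ : GBC n} {S : Finset (GBC n)} (hχ : χ.IsExpr)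
    (hS : χ.subexprs ⊆ S) (h : ψ ∈ χ.conv.subexprs) :
    (∃ a ∈ S, ψ = a.conv) ∨ ∃ op a b i, bin op a b ∈ S ∧ ψ = chain op a b i := by
  have hself := hS (self_mem_subexprs χ)
  induction χ with
  | top | bot | var x =>
    simp only [conv, subexprs, Finset.mem_singleton] at h
    exact Or.inl ⟨_, hself, h⟩
  | neg φ ih | proj x b φ ih =>
    have hS' := (Finset.subset_insert _ _).trans hS
    simp only [conv, subexprs, Finset.mem_insert] at h
    rcases h with h | h
    · exact Or.inl ⟨_, hself, h⟩
    · exact ih hχ hS' h (hS' (self_mem_subexprs φ))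
  | ren y x φ ih =>
    have hS' := (Finset.subset_insert _ _).trans hS
    simp only [conv, subexprs, Finset.mem_insert] at h
    rcases h with h | h
    · exact Or.inl ⟨_, hself, h⟩
    · exact ih hχ.1 hS' h (hS' (self_mem_subexprs φ))
  | bin op φ φ' ih₁ ih₂ =>
    have hS₁ := (Finset.subset_union_left.trans (Finset.subset_insert _ _)).trans hS
    have hS₂ := (Finset.subset_union_right.trans (Finset.subset_insert _ _)).trans hS
    rcases mem_subexprs_foldr_delta h with h | ⟨i, h⟩
    · simp only [subexprs, Finset.mem_insert, Finset.mem_union] at h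
      rcases h with h | h | h
      · exact Or.inr ⟨op, φ, φ', n, hself, by rw [chain_of_le _ _ _ le_rfl, h]⟩
      · exact ih₁ hχ.1 hS₁ h (hS₁ (self_mem_subexprs φ))
      · exact ih₂ hχ.2 hS₂ h (hS₂ (self_mem_subexprs φ'))
    · exact Or.inr ⟨op, φ, φ', i, hself, h⟩
  | delta x φ ih => exact hχ.elim

theorem conv_mem_subexprs_conv {a χ : GBC n} (h : a ∈ χ.subexprs) :
    a.conv ∈ χ.conv.subexprs := by
  have chain_sub : ∀ (l : List (Fin n)) (ψ : GBC n), ψ.subexprs ⊆ (l.foldr delta ψ).subexprs := by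
    intro l ψ
    induction l with
    | nil => rfl
    | cons x l ih => exact ih.trans (Finset.subset_insert _ _)
  induction χ with
  | top | bot | var x =>
    simp only [subexprs, Finset.mem_singleton] at h
    rw [h]
    exact self_mem_subexprs _
  | neg φ ih | proj x b φ ih | ren y x φ ih | delta x φ ih =>
    simp only [subexprs, Finset.mem_insert] at h
    rcases h with rfl | h
    · exact self_mem_subexprs _
    · exact Finset.mem_insert_of_mem (ih h)
  | bin op φ φ' ih₁ ih₂ =>
    simp only [subexprs, Finset.mem_insert, Finset.mem_union] at h
    rcases h with rfl | h | h
    · exact self_mem_subexprs _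
    · exact chain_sub _ _ (by simp [subexprs, ih₁ h])
    · exact chain_sub _ _ (by simp [subexprs, ih₂ h])

theorem chain_injective {op op' : Bool → Bool → Bool} {a b a' b' : GBC n} {i j : ℕ} (hi : i ≤ n)
    (hj : j ≤ n) (h : chain op a b i = chain op' a' b' j) : i = j := by
  have foldr_inj : ∀ l l' : List (Fin n), l.foldr delta (bin op a.conv b.conv)
      = l'.foldr delta (bin op' a'.conv b'.conv) → l = l' := by
    intro l
    induction l with
    | nil => intro l' h; cases l' <;> simp_all
    | cons x l ih =>
      intro l' h
      cases l' with
      | nil => simp at h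
      | cons y l' =>
        simp only [List.foldr_cons, delta.injEq] at h
        rw [h.1, ih _ h.2]
  have := congrArg List.length (foldr_inj _ _ h)
  simp at this
  omega

/-- Whether the gate is a degree reduction. -/
def IsDelta : GBC n → Prop
  | delta _ _ => True
  | _ => False

instance : DecidablePred (IsDelta (n := n)) := fun ψ => by
  cases ψ <;> simp only [IsDelta] <;> infer_instance

end GBC

section Circuit

open GBC

variable {n p : ℕ}

/-- The gates of the degree-reduced circuit that stand for gates of the circuit with outputs
`φ`. -/
def principalGates (φ : Finset (GBC n)) : Finset (GBC n) :=
  (circuitGates φ).image conv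

/-- The gates of the degree-reduced circuit. -/
abbrev reducedGates (φ : Finset (GBC n)) : Finset (GBC n) :=
  circuitGates (φ.image conv)

theorem subexprs_subset_circuitGates {φ : Finset (GBC n)} {a : GBC n} (h : a ∈ circuitGates φ) :
    a.subexprs ⊆ circuitGates φ := by
  obtain ⟨χ, hχ, ha⟩ := Finset.mem_biUnion.1 h
  exact (subexprs_subset ha).trans (Finset.subset_biUnion_of_mem subexprs hχ)

theorem children_subset_circuitGates {φ : Finset (GBC n)} {a : GBC n} (h : a ∈ circuitGates φ) :
    a.children ⊆ circuitGates φ :=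
  (children_subset_subexprs a).trans (subexprs_subset_circuitGates h)

theorem principalGates_subset (φ : Finset (GBC n)) : principalGates φ ⊆ reducedGates φ := by
  intro ψ hψ
  obtain ⟨a, ha, rfl⟩ := Finset.mem_image.1 hψ
  obtain ⟨χ, hχ, ha⟩ := Finset.mem_biUnion.1 ha
  exact Finset.mem_biUnion.2 ⟨χ.conv, Finset.mem_image_of_mem _ hχ, conv_mem_subexprs_conv ha⟩

variable {φ : Finset (GBC n)}

theorem isExpr_of_mem_circuitGates (hφ : ∀ χ ∈ φ, χ.IsExpr)
    {a : GBC n} (ha : a ∈ circuitGates φ) : a.IsExpr := by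
  obtain ⟨χ, hχ, ha⟩ := Finset.mem_biUnion.1 ha
  exact (hφ χ hχ).of_mem_subexprs ha

theorem mem_reducedGates (hφ : ∀ χ ∈ φ, χ.IsExpr)
    {ψ : GBC n} (h : ψ ∈ reducedGates φ) :
    (∃ a ∈ circuitGates φ, ψ = a.conv) ∨
      ∃ op a b i, bin op a b ∈ circuitGates φ ∧ ψ = chain op a b i := by
  obtain ⟨χ', hχ', h⟩ := Finset.mem_biUnion.1 h
  obtain ⟨χ, hχ, rfl⟩ := Finset.mem_image.1 hχ'
  exact mem_subexprs_conv (hφ χ hχ) (Finset.subset_biUnion_of_mem subexprs hχ) h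

/-- A degree reduction that is a gate belongs to one of the chains. -/
theorem delta_mem_reducedGates (hφ : ∀ χ ∈ φ, χ.IsExpr)
    {x : Fin n} {c : GBC n} (h : delta x c ∈ reducedGates φ) :
    ∃ op a b, bin op a b ∈ circuitGates φ ∧ delta x c = chain op a b x ∧
      c = chain op a b (x + 1) := by
  have of_chain : ∀ op a b i, bin op a b ∈ circuitGates φ → delta x c = chain op a b i →
      ∃ op a b, bin op a b ∈ circuitGates φ ∧ delta x c = chain op a b x ∧
        c = chain op a b (x + 1) := by
    intro op a b i hm h
    rcases lt_or_ge i n with hi | hi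
    · have h' := h
      rw [chain_of_lt _ _ _ hi, delta.injEq] at h'
      obtain ⟨rfl, hc⟩ := h'
      exact ⟨op, a, b, hm, h, hc⟩
    · rw [chain_of_le _ _ _ hi] at h
      simp at h
  rcases mem_reducedGates hφ h with ⟨a, ha, h⟩ | ⟨op, a, b, i, ha, h⟩
  · cases a with
    | bin op a b => exact of_chain op a b 0 ha h
    | delta x a => exact (isExpr_of_mem_circuitGates hφ ha).elim
    | _ => simp [conv] at h
  · exact of_chain op a b i ha h

/-- Every gate of the degree-reduced circuit has degree at most two in each variable. -/
theorem degreeInLE_of_mem_reducedGates (hφ : ∀ χ ∈ φ, χ.IsExpr)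
    {ψ : GBC n} (h : ψ ∈ reducedGates φ) (z : Fin n) :
    DegreeInLE p ψ z 2 := by
  rcases mem_reducedGates hφ h with ⟨a, ha, rfl⟩ | ⟨op, a, b, i, ha, rfl⟩
  · exact fun σ => (degreeInLE_conv (isExpr_of_mem_circuitGates hφ ha) z σ).trans one_le_two
  · have hab := isExpr_of_mem_circuitGates hφ ha
    exact degreeInLE_foldr_delta _
      (fun _ => (degreeInLE_conv hab.1 z).bin (degreeInLE_conv hab.2 z) op) one_le_two

/-- A gate inside a chain has degree reductions as its only predecessors. -/
theorem isDelta_of_child_notMem (hφ : ∀ χ ∈ φ, χ.IsExpr)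
    {ψ c : GBC n} (h : ψ ∈ reducedGates φ) (hc : c ∈ ψ.children)
    (hcp : c ∉ principalGates φ) : ψ.IsDelta := by
  have mem : ∀ {a b : GBC n}, a ∈ circuitGates φ → b ∈ a.children →
      b.conv ∈ principalGates φ := fun ha hb =>
    Finset.mem_image_of_mem _ (children_subset_circuitGates ha hb)
  have of_chain : ∀ op a b i, bin op a b ∈ circuitGates φ → ψ = chain op a b i →
      ψ.IsDelta := by
    rintro op a b i ha rfl
    rcases lt_or_ge i n with hi | hi
    · rw [chain_of_lt _ _ _ hi]; trivial
    · rw [chain_of_le _ _ _ hi] at hc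
      simp only [children, Finset.mem_insert, Finset.mem_singleton] at hc
      rcases hc with rfl | rfl
      · exact absurd (mem ha (by simp [children])) hcp
      · exact absurd (mem ha (by simp [children])) hcp
  rcases mem_reducedGates hφ h with ⟨a, ha, h⟩ | ⟨op, a, b, i, ha, h⟩
  · cases a with
    | bin op a b => exact of_chain op a b 0 ha h
    | delta x a => exact (isExpr_of_mem_circuitGates hφ ha).elim
    | top | bot | var x => simp [h, conv, children] at hc
    | neg a | proj x b a | ren y x a =>
      rw [h, conv, children, Finset.mem_singleton] at hc
      exact absurd (hc ▸ mem ha (by simp [children])) hcp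
  · exact of_chain op a b i ha h

/-- A gate has at most one degree reduction as a predecessor. -/
theorem delta_parent_unique (hφ : ∀ χ ∈ φ, χ.IsExpr)
    {ψ ψ' c : GBC n} (h : ψ ∈ reducedGates φ) (h' : ψ' ∈ reducedGates φ)
    (hc : c ∈ ψ.children) (hc' : c ∈ ψ'.children) (hd : ψ.IsDelta) (hd' : ψ'.IsDelta) :
    ψ = ψ' := by
  cases ψ with
  | delta x d =>
    cases ψ' with
    | delta y e =>
      simp only [children, Finset.mem_singleton] at hc hc'
      subst hc hc'
      obtain ⟨op, a, b, -, -, h⟩ := delta_mem_reducedGates hφ h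
      obtain ⟨op', a', b', -, -, h'⟩ := delta_mem_reducedGates hφ h'
      have := chain_injective (by omega) (by omega) (h.symm.trans h')
      rw [Fin.ext (Nat.succ_injective this)]
    | _ => exact hd'.elim
  | _ => exact hd.elim

theorem card_delta_le (hφ : ∀ χ ∈ φ, χ.IsExpr) :
    ((reducedGates φ).filter IsDelta).card ≤ n * (circuitGates φ).card := by
  classical
  -- a degree reduction is determined by its chain and its variable
  let f : GBC n × Fin n → GBC n := fun q => match q.1 with
    | bin op a b => chain op a b q.2
    | _ => top
  have hsub : (reducedGates φ).filter IsDelta ⊆ (circuitGates φ ×ˢ Finset.univ).image f := by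
    intro ψ hψ
    obtain ⟨hψ, hd⟩ := Finset.mem_filter.1 hψ
    cases ψ with
    | delta x c =>
      obtain ⟨op, a, b, ha, h, -⟩ := delta_mem_reducedGates hφ hψ
      exact Finset.mem_image.2 ⟨(bin op a b, x), by simp [ha], h.symm⟩
    | _ => exact hd.elim
  refine (Finset.card_le_card hsub).trans (Finset.card_image_le.trans ?_)
  rw [Finset.card_product, Finset.card_univ, Fintype.card_fin, mul_comm]

/-- The number of bad random values in the round of a gate: two for each variable in merging, which
happens at principal gates only, and two for a degree reduction. -/
def gateCost (φ : Finset (GBC n)) (ψ : GBC n) : ℕ :=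
  (if ψ ∈ principalGates φ then 2 * n else 0) + if ψ.IsDelta then 2 else 0

theorem sum_gateCost_le (hφ : ∀ χ ∈ φ, χ.IsExpr) :
    ∑ ψ ∈ reducedGates φ, gateCost φ ψ ≤ 4 * n * (circuitGates φ).card := by
  have h1 : (principalGates φ).card ≤ (circuitGates φ).card := Finset.card_image_le
  have h2 := card_delta_le hφ
  simp only [gateCost]
  rw [Finset.sum_add_distrib, Finset.sum_ite_mem, ← Finset.sum_filter, Finset.sum_const,
    Finset.sum_const, Finset.inter_eq_right.2 (principalGates_subset φ), smul_eq_mul, smul_eq_mul]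
  nlinarith

end Circuit

/-! ### Merging and propagating claims -/

section Rounds

open GBC Program

variable {n p : ℕ}

namespace EvalClaim

/-- The evaluation claim is true. -/
def Holds (c : EvalClaim n p) : Prop :=
  eval c.asg (c.gate.arith p) = c.val

/-- Only the entries at free variables of the gate are recorded. -/
def Blanked (c : EvalClaim n p) : Prop :=
  ∀ x ∉ c.gate.free, c.asg x = 0

@[simp]
theorem gate_mk' (ψ : GBC n) (σ : Assignment n p) (k : ZMod p) : (mk' ψ σ k).gate = ψ := rfl

theorem holds_mk' {ψ : GBC n} {σ : Assignment n p} {k : ZMod p} :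
    (mk' ψ σ k).Holds ↔ eval σ (ψ.arith p) = k := by
  rw [Holds, mk', eval_arith_congr (p := p) ψ (σ' := σ) fun x hx => if_pos hx]

theorem blanked_mk' (ψ : GBC n) (σ : Assignment n p) (k : ZMod p) : (mk' ψ σ k).Blanked :=
  fun _ hx => if_neg hx

end EvalClaim

open EvalClaim

/-- The polynomial of `ψ` takes the value `c.2` at `c.1`. -/
def PairHolds (ψ : GBC n) (c : Assignment n p × ZMod p) : Prop :=
  eval c.1 (ψ.arith p) = c.2

/-- Restricting to a variable and evaluating at the entry of that variable is evaluating. -/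
theorem eval_evalExcept_self (σ : Assignment n p) (x : Fin n)
    (q : MvPolynomial (Fin n) (ZMod p)) : (evalExcept σ x q).eval (σ x) = eval σ q := by
  rw [eval_evalExcept, Function.update_eq_self]

theorem degreeReduce_check (σ : Assignment n p) (x : Fin n) (ψ : GBC n) :
    σ x * (evalExcept σ x (ψ.arith p)).eval 1 + (1 - σ x) * (evalExcept σ x (ψ.arith p)).eval 0
      = eval σ (arith p (delta x ψ)) := by
  rw [eval_evalExcept, eval_evalExcept, eval_arith_delta]

theorem exists_card_le_two_eval_ne [Fact p.Prime] {f g : Polynomial (ZMod p)}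
    (hf : f.natDegree ≤ 2) (hg : g.natDegree ≤ 2) (h : f ≠ g) :
    ∃ bad : Finset (ZMod p), bad.card ≤ 2 ∧ ∀ r ∉ bad, f.eval r ≠ g.eval r := by
  refine ⟨(f - g).roots.toFinset, ?_, fun r hr he => hr ?_⟩
  · exact (Multiset.toFinset_card_le _).trans ((Polynomial.card_roots' _).trans
      (Polynomial.natDegree_sub_le_of_le hf hg))
  · rw [Multiset.mem_toFinset, Polynomial.mem_roots (sub_ne_zero.2 h)]
    simp [he]

theorem Program.failLe_true [NeZero p] {α : Type} (m : Program n p α) :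
    FailLe (fun _ => True) m 0 := by
  induction m with
  | pure a => exact .pure trivial
  | reject => exact .reject
  | ask c next ih => exact .ask ih
  | sample next ih => exact .sample (m := 0) ∅ (by simp) fun r _ => ih r
  | sampleAssignment next ih => exact .sampleAssignment (m := 0) ∅ (by simp) fun r _ => ih r

section Soundness

variable [Fact p.Prime]

/-- If a claim is false, then Prover can only pass the consistency check by sending a wrong
polynomial. -/
theorem failLe_mergeAsk {ψ : GBC n} {x : Fin n} {C : List (Assignment n p × ZMod p)}
    (h : ∃ c ∈ C, ¬ PairHolds ψ c) :
    FailLe (fun C' => ∃ c ∈ C', c.2.natDegree ≤ 2 ∧ c.2 ≠ evalExcept c.1 x (ψ.arith p))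
      (mergeAsk ψ x C) 0 := by
  induction C with
  | nil => simp at h
  | cons c C ih =>
    obtain ⟨σ, k⟩ := c
    refine .ask fun (q : Polynomial (ZMod p)) => ?_
    by_cases hq : q.natDegree ≤ 2 ∧ q.eval (σ x) = k
    · rw [if_pos hq]
      by_cases hc : PairHolds ψ (σ, k)
      · have hC : ∃ c ∈ C, ¬ PairHolds ψ c := by
          obtain ⟨c, hcm, hcf⟩ := h
          rcases List.mem_cons.1 hcm with rfl | hcm
          · exact absurd hc hcf
          · exact ⟨c, hcm, hcf⟩
        exact (ih hC).bind (l := 0) fun C' ⟨c, hc, h⟩ => .pure ⟨c, List.mem_cons_of_mem _ hc, h⟩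
      · refine (failLe_true _).bind (l := 0) fun C' _ =>
          .pure ⟨(σ, q), List.mem_cons_self, hq.1, fun he => hc ?_⟩
        simp only at he
        rw [PairHolds, ← hq.2, he, eval_evalExcept_self]
    · rw [if_neg hq]
      exact .reject

theorem failLe_mergeLoop {ψ : GBC n} (hψ : ∀ x, DegreeInLE p ψ x 2) (xs : List (Fin n))
    {C : List (Assignment n p × ZMod p)} (h : ∃ c ∈ C, ¬ PairHolds ψ c) :
    FailLe (fun C' => ∃ c ∈ C', ¬ PairHolds ψ c) (mergeLoop ψ xs C) (2 * xs.length) := by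
  induction xs generalizing C with
  | nil => exact .pure h
  | cons x xs ih =>
    have hk : 2 * (x :: xs).length = 0 + (2 + 2 * xs.length) := by simp; ring
    rw [hk]
    refine (failLe_mergeAsk h).bind fun C' ⟨c, hc, hdeg, hne⟩ => ?_
    obtain ⟨bad, hbad, hr⟩ := exists_card_le_two_eval_ne hdeg (hψ x c.1) hne
    refine .sample bad hbad fun r hrb => ih ⟨_, List.mem_dedup.2 (List.mem_map_of_mem hc), ?_⟩
    rw [PairHolds, ← eval_evalExcept]
    exact (hr r hrb).symm

/-- Merging loses a false claim with probability at most `2 n / p`, and never if there is nothing to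
merge. -/
theorem failLe_merge {ψ : GBC n} (hψ : ∀ x, DegreeInLE p ψ x 2)
    (C : List (Assignment n p × ZMod p)) :
    FailLe (fun c => (∃ c ∈ C, ¬ PairHolds ψ c) → ¬ PairHolds ψ c) (merge ψ C)
      (if C.length ≤ 1 then 0 else 2 * n) := by
  by_cases h : ∃ c ∈ C, ¬ PairHolds ψ c
  · match C with
    | [] => simp at h
    | [c] => exact .pure fun _ => by simpa using h
    | c :: d :: C =>
      have hlen : 2 * ((List.finRange n).filter (· ∈ ψ.free)).length + 0
          ≤ if (c :: d :: C).length ≤ 1 then 0 else 2 * n := by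
        have := List.length_filter_le (fun x => decide (x ∈ ψ.free)) (List.finRange n)
        rw [List.length_finRange] at this
        rw [if_neg (by simp)]
        omega
      refine FailLe.mono ?_ (fun _ h => h) hlen
      refine (failLe_mergeLoop hψ _ h).bind fun C' hC' => ?_
      match C' with
      | [] => exact .reject
      | [c] => exact .pure fun _ => by simpa using hC'
      | _ :: _ :: _ => exact .reject
  · exact (failLe_true _).mono (fun _ _ h' => absurd h' h) (Nat.zero_le _)

/-- Propagation turns a false claim about a gate into a false claim about one of its children, except
with probability `2 / p` at a degree reduction. -/
theorem failLe_propagate {ψ : GBC n} (hψ : ∀ c ∈ ψ.children, ∀ x, DegreeInLE p c x 2)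
    (σ : Assignment n p) (k : ZMod p) :
    FailLe (fun C' => (¬ PairHolds ψ (σ, k) → ∃ c ∈ C', ¬ c.Holds)
        ∧ (∀ c ∈ C', c.gate ∈ ψ.children) ∧ (ψ.IsDelta → C'.length ≤ 1))
      (propagate σ k ψ) (if ψ.IsDelta then 2 else 0) := by
  cases ψ with
  | top =>
    rw [propagate]
    by_cases h : (1 : ZMod p) = k
    · rw [if_pos h]
      exact .pure ⟨fun hf => absurd (by simp [PairHolds, arith, h]) hf, by simp, by simp⟩
    · rw [if_neg h]
      exact .reject
  | bot =>
    rw [propagate]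
    by_cases h : (0 : ZMod p) = k
    · rw [if_pos h]
      exact .pure ⟨fun hf => absurd (by simp [PairHolds, arith, h]) hf, by simp, by simp⟩
    · rw [if_neg h]
      exact .reject
  | var x =>
    rw [propagate]
    by_cases h : σ x = k
    · rw [if_pos h]
      exact .pure ⟨fun hf => absurd (by simp [PairHolds, arith, h]) hf, by simp, by simp⟩
    · rw [if_neg h]
      exact .reject
  | neg ψ =>
    refine .ask fun (a : ZMod p) => ?_
    by_cases h : 1 - a = k
    · rw [if_pos h]
      refine .pure ⟨fun hf => ⟨_, List.mem_singleton_self _, fun ht => hf ?_⟩, by simp [children],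
        by simp⟩
      rw [holds_mk'] at ht
      simp only [PairHolds]
      rw [eval_arith_neg, ht, h]
    · rw [if_neg h]
      exact .reject
  | bin op ψ₁ ψ₂ =>
    refine .ask fun (a : ZMod p) => .ask fun (b : ZMod p) => ?_
    by_cases h : arithOp op a b = k
    · rw [if_pos h]
      refine .pure ⟨fun hf => ?_, by simp [children], fun hd => hd.elim⟩
      by_contra! hall
      have h₁ := hall (mk' ψ₁ σ a) (by simp)
      have h₂ := hall (mk' ψ₂ σ b) (by simp)
      rw [holds_mk'] at h₁ h₂
      apply hf
      simp only [PairHolds]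
      rw [eval_arith_bin, h₁, h₂, h]
    · rw [if_neg h]
      exact .reject
  | proj x b ψ =>
    refine .pure ⟨fun hf => ⟨_, List.mem_singleton_self _, fun ht => hf ?_⟩, by simp [children],
      by simp⟩
    rw [holds_mk'] at ht
    simp only [PairHolds]
    rw [eval_arith_proj, ht]
  | ren y x ψ =>
    refine .pure ⟨fun hf => ⟨_, List.mem_singleton_self _, fun ht => hf ?_⟩, by simp [children],
      by simp⟩
    rw [holds_mk'] at ht
    simp only [PairHolds]
    rw [eval_arith_ren, ht]
  | delta x ψ =>
    refine .ask fun (q : Polynomial (ZMod p)) => ?_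
    by_cases h : q.natDegree ≤ 2 ∧ σ x * q.eval 1 + (1 - σ x) * q.eval 0 = k
    · rw [if_pos h]
      have hd : (if (delta x ψ).IsDelta then 2 else 0) = 2 + 0 := if_pos trivial
      rw [hd]
      by_cases hc : PairHolds (delta x ψ) (σ, k)
      · exact .sample ∅ (by simp) fun r _ =>
          .pure ⟨fun hf => absurd hc hf, by simp [children], by simp⟩
      · have hne : q ≠ evalExcept σ x (ψ.arith p) := fun he => hc <| by
          simp only [PairHolds]
          rw [← degreeReduce_check, ← he, h.2]
        obtain ⟨bad, hbad, hr⟩ :=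
          exists_card_le_two_eval_ne h.1 (hψ ψ (by simp [children]) x σ) hne
        refine .sample bad hbad fun r hrb =>
          .pure ⟨fun _ => ⟨_, List.mem_singleton_self _, fun ht => hr r hrb ?_⟩,
            by simp [children], by simp⟩
        rw [holds_mk'] at ht
        rw [eval_evalExcept, ht]
    · rw [if_neg h]
      exact .reject

/-- The rounds of Verifier accept an initial false claim with probability at most the sum of the
costs of the gates. The invariant `hinv` says that a gate inside a chain of degree reductions never
needs merging: it receives a single claim, from its unique predecessor. -/
theorem failLe_certifyAssignments {φ : Finset (GBC n)} (hφ : ∀ χ ∈ φ, χ.IsExpr)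
    {order : List (GBC n)} {C : List (EvalClaim n p)} (hG : ∀ ψ ∈ order, ψ ∈ reducedGates φ)
    (htop : order.Pairwise fun a b => a ∉ b.children)
    (hclosed : ∀ ψ ∈ order, ∀ c ∈ ψ.children, c ∈ order)
    (hinv : ∀ ψ ∉ principalGates φ, (C.filter (·.gate = ψ)).length
      + (order.filter (ψ ∈ ·.children)).length ≤ 1)
    (hC : ∃ c ∈ C, c.gate ∈ order ∧ ¬ c.Holds) :
    FailLe (fun _ => False) (certifyAssignments order C) (order.map (gateCost φ)).sum := by
  induction order generalizing C with
  | nil => simp at hC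
  | cons ψ order ih =>
    have hψG := hG ψ List.mem_cons_self
    have hG' : ∀ χ ∈ order, χ ∈ reducedGates φ := fun χ hχ => hG χ (List.mem_cons_of_mem _ hχ)
    obtain ⟨hhead, htail⟩ := List.pairwise_cons.1 htop
    have hclosed' : ∀ χ ∈ order, ∀ c ∈ χ.children, c ∈ order := fun χ hχ c hc => by
      rcases List.mem_cons.1 (hclosed χ (List.mem_cons_of_mem _ hχ) c hc) with rfl | h
      · exact absurd hc (hhead χ hχ)
      · exact h
    have hchild : ∀ c ∈ ψ.children, c ∈ order := fun c hc => by
      rcases List.mem_cons.1 (hclosed ψ List.mem_cons_self c hc) with rfl | h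
      · exact absurd hc (notMem_children_self c)
      · exact h
    have hfilter : ∀ χ : GBC n, ((ψ :: order).filter (χ ∈ ·.children)).length
        = (if χ ∈ ψ.children then 1 else 0) + (order.filter (χ ∈ ·.children)).length := fun χ => by
      by_cases h : χ ∈ ψ.children
      · simp [h, add_comm]
      · simp [h]
    rw [List.map_cons, List.sum_cons, certifyAssignments]
    generalize hL : ((C.filter (·.gate = ψ)).map fun c => (c.asg, c.val)).dedup = L
    have hmemL : ∀ c ∈ C, c.gate = ψ → (c.asg, c.val) ∈ L := fun c hc hcψ =>
      hL ▸ List.mem_dedup.2 (List.mem_map_of_mem (List.mem_filter.2 ⟨hc, by simpa using hcψ⟩))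
    -- the round of a gate about which there is a claim
    have round : FailLe (fun _ => False) ((merge ψ L).bind fun c =>
        (propagate c.1 c.2 ψ).bind fun C' => certifyAssignments order (C ++ C'))
        (gateCost φ ψ + (order.map (gateCost φ)).sum) := by
      have hcost : (if L.length ≤ 1 then 0 else 2 * n)
          ≤ if ψ ∈ principalGates φ then 2 * n else 0 := by
        by_cases hp : ψ ∈ principalGates φ
        · rw [if_pos hp]; split_ifs <;> simp
        · have h1 : L.length ≤ ((C.filter (·.gate = ψ)).map fun c => (c.asg, c.val)).length :=
            hL ▸ (List.dedup_sublist _).length_le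
          have h2 := hinv ψ hp
          rw [List.length_map] at h1
          rw [if_neg hp, if_pos (by omega)]
      refine FailLe.mono ?_ (fun _ h => h) (Nat.add_le_add_right (Nat.add_le_add_right hcost _) _)
      rw [add_assoc]
      refine (failLe_merge (degreeInLE_of_mem_reducedGates hφ hψG) L).bind fun c hc => ?_
      refine (failLe_propagate (fun d hd => degreeInLE_of_mem_reducedGates hφ
        (hG' d (hchild d hd))) c.1 c.2).bind fun C' ⟨hfalse, hgates, hlen⟩ => ?_
      refine ih hG' htail hclosed' (fun χ hχ => ?_) ?_
      · have h1 := hinv χ hχ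
        rw [hfilter] at h1
        rw [List.filter_append, List.length_append]
        by_cases hχψ : χ ∈ ψ.children
        · have h2 := hlen (isDelta_of_child_notMem hφ hψG hχψ hχ)
          have h3 := List.length_filter_le (fun c : EvalClaim n p => decide (c.gate = χ)) C'
          rw [if_pos hχψ] at h1
          omega
        · have h2 : C'.filter (·.gate = χ) = [] := List.filter_eq_nil_iff.2 fun c hc => by
            have := hgates c hc
            simp only [decide_eq_true_eq]
            exact fun h => hχψ (h ▸ this)
          rw [h2, List.length_nil]
          omega
      · obtain ⟨d, hd, hdo, hdf⟩ := hC
        rcases List.mem_cons.1 hdo with hdψ | hdo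
        · obtain ⟨e, he, hef⟩ := hfalse (hc ⟨_, hmemL d hd hdψ, by rw [← hdψ]; exact hdf⟩)
          exact ⟨e, List.mem_append_right _ he, hchild _ (hgates e he), hef⟩
        · exact ⟨d, List.mem_append_left _ hd, hdo, hdf⟩
    split
    · refine (ih hG' htail hclosed' (fun χ hχ => ?_) ?_).mono (fun _ h => h) (Nat.le_add_left _ _)
      · have h1 := hinv χ hχ
        rw [hfilter] at h1
        omega
      · obtain ⟨d, hd, hdo, hdf⟩ := hC
        rcases List.mem_cons.1 hdo with hdψ | hdo
        · have := hmemL d hd hdψ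
          simp at this
        · exact ⟨d, hd, hdo, hdf⟩
    · exact round

end Soundness

section Completeness

theorem succeeds_mergeAsk {ψ : GBC n} {x : Fin n} (hψ : DegreeInLE p ψ x 2)
    {C : List (Assignment n p × ZMod p)} (h : ∀ c ∈ C, PairHolds ψ c) :
    Succeeds (fun C' => C' = C.map fun c => (c.1, evalExcept c.1 x (ψ.arith p)))
      (mergeAsk ψ x C) := by
  induction C with
  | nil => exact .pure rfl
  | cons c C ih =>
    obtain ⟨σ, k⟩ := c
    refine .ask fun (q : Polynomial (ZMod p)) hq => ?_
    replace hq : q = _root_.evalExcept (Function.update σ x 0) x (ψ.arith p) := hq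
    rw [evalExcept_update] at hq
    have hk : PairHolds ψ (σ, k) := h _ List.mem_cons_self
    rw [if_pos ⟨hq ▸ hψ σ, by rw [hq, eval_evalExcept_self]; exact hk⟩]
    refine (ih fun c hc => h c (List.mem_cons_of_mem _ hc)).bind fun C' hC' => .pure ?_
    rw [hC', hq, List.map_cons]

theorem succeeds_mergeLoop {ψ : GBC n} (hψ : ∀ x, DegreeInLE p ψ x 2) {xs : List (Fin n)}
    {C : List (Assignment n p × ZMod p)} (h : ∀ c ∈ C, PairHolds ψ c) (hne : C ≠ [])
    (hnd : C.Nodup) (hagree : ∀ c ∈ C, ∀ c' ∈ C, ∀ y ∉ xs, c.1 y = c'.1 y) :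
    Succeeds (fun C' => ∃ c, C' = [c] ∧ PairHolds ψ c) (mergeLoop ψ xs C) := by
  induction xs generalizing C with
  | nil =>
    refine .pure ?_
    match C with
    | [] => exact absurd rfl hne
    | [c] => exact ⟨c, rfl, h c (by simp)⟩
    | c :: d :: C =>
      have h1 : c.1 = d.1 := funext fun y => hagree c (by simp) d (by simp) y (by simp)
      have h2 : c.2 = d.2 := by
        have hc := h c (by simp)
        have hd := h d (by simp)
        rw [PairHolds] at hc hd
        rw [← hc, ← hd, h1]
      have := Prod.ext h1 h2
      simp [this] at hnd
  | cons x xs ih =>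
    refine (succeeds_mergeAsk (hψ x) h).bind fun C' hC' => .sample fun r => ?_
    have hmem : ∀ c ∈ (C'.map fun c => (Function.update c.1 x r, c.2.eval r)).dedup,
        ∃ d ∈ C, c = (Function.update d.1 x r, eval (Function.update d.1 x r) (ψ.arith p)) := by
      intro c hc
      rw [List.mem_dedup, hC', List.map_map] at hc
      obtain ⟨d, hd, rfl⟩ := List.mem_map.1 hc
      exact ⟨d, hd, by simp [eval_evalExcept]⟩
    refine ih (fun c hc => ?_) ?_ (List.nodup_dedup _) fun c hc c' hc' y hy => ?_
    · obtain ⟨d, -, rfl⟩ := hmem c hc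
      rfl
    · rw [Ne, List.dedup_eq_nil, List.map_eq_nil_iff, hC', List.map_eq_nil_iff]
      exact hne
    · obtain ⟨d, hd, rfl⟩ := hmem c hc
      obtain ⟨d', hd', rfl⟩ := hmem c' hc'
      rcases eq_or_ne y x with rfl | hyx
      · simp
      · simpa [hyx] using hagree d hd d' hd' y (by simp [hyx, hy])

theorem succeeds_merge {ψ : GBC n} (hψ : ∀ x, DegreeInLE p ψ x 2)
    {C : List (Assignment n p × ZMod p)} (h : ∀ c ∈ C, PairHolds ψ c) (hne : C ≠ [])
    (hnd : C.Nodup) (hblank : ∀ c ∈ C, ∀ x ∉ ψ.free, c.1 x = 0) :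
    Succeeds (PairHolds ψ) (merge ψ C) := by
  match C with
  | [] => exact absurd rfl hne
  | [c] => exact .pure (h c (by simp))
  | c :: d :: C =>
    refine (succeeds_mergeLoop hψ h hne hnd fun c hc c' hc' y hy => ?_).bind fun C' hC' => ?_
    · have hy' : y ∉ ψ.free := by simpa using hy
      rw [hblank c hc y hy', hblank c' hc' y hy']
    · obtain ⟨c, rfl, hc⟩ := hC'
      exact .pure hc

theorem succeeds_propagate {ψ : GBC n} (hψ : ∀ c ∈ ψ.children, ∀ x, DegreeInLE p c x 2)
    {σ : Assignment n p} {k : ZMod p} (h : PairHolds ψ (σ, k)) :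
    Succeeds (fun C' => ∀ c ∈ C', c.Holds ∧ c.Blanked) (propagate σ k ψ) := by
  replace h : eval σ (ψ.arith p) = k := h
  have single : ∀ {χ : GBC n} {ρ : Assignment n p} {a : ZMod p}, eval ρ (χ.arith p) = a →
      ∀ c ∈ [mk' χ ρ a], c.Holds ∧ c.Blanked := fun hv c hc => by
    rw [List.mem_singleton.1 hc]
    exact ⟨holds_mk'.2 hv, blanked_mk' _ _ _⟩
  cases ψ with
  | top =>
    rw [propagate, if_pos (by simpa [arith] using h)]
    exact .pure (by simp)
  | bot =>
    rw [propagate, if_pos (by simpa [arith] using h)]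
    exact .pure (by simp)
  | var x =>
    rw [propagate, if_pos (by simpa [arith] using h)]
    exact .pure (by simp)
  | neg ψ =>
    refine .ask fun (a : ZMod p) ha => ?_
    replace ha : a = eval σ (ψ.arith p) := ha
    rw [if_pos (by rw [ha, ← eval_arith_neg, h])]
    exact .pure (single ha.symm)
  | bin op ψ₁ ψ₂ =>
    refine .ask fun (a : ZMod p) ha => .ask fun (b : ZMod p) hb => ?_
    replace ha : a = eval σ (ψ₁.arith p) := ha
    replace hb : b = eval σ (ψ₂.arith p) := hb
    rw [if_pos (by rw [ha, hb, ← eval_arith_bin, h])]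
    refine .pure fun c hc => ?_
    rcases List.mem_cons.1 hc with hc | hc
    · exact single ha.symm c (List.mem_singleton.2 hc)
    · exact single hb.symm c hc
  | proj x b ψ => exact .pure (single (by rw [← eval_arith_proj, h]))
  | ren y x ψ => exact .pure (single (by rw [← eval_arith_ren, h]))
  | delta x ψ =>
    refine .ask fun (q : Polynomial (ZMod p)) hq => ?_
    replace hq : q = _root_.evalExcept (Function.update σ x 0) x (ψ.arith p) := hq
    rw [evalExcept_update] at hq
    rw [if_pos ⟨hq ▸ hψ ψ (by simp [children]) x σ, by rw [hq, degreeReduce_check, h]⟩]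
    exact .sample fun r => .pure (single (by rw [hq, eval_evalExcept]))

theorem succeeds_certifyAssignments {order : List (GBC n)} {C : List (EvalClaim n p)}
    (hdeg : ∀ ψ ∈ order, ∀ x, DegreeInLE p ψ x 2)
    (hdeg' : ∀ ψ ∈ order, ∀ c ∈ ψ.children, ∀ x, DegreeInLE p c x 2)
    (hC : ∀ c ∈ C, c.Holds ∧ c.Blanked) :
    Succeeds (fun _ => True) (certifyAssignments order C) := by
  induction order generalizing C with
  | nil => exact .pure trivial
  | cons ψ order ih =>
    replace ih := fun C => @ih C (fun χ hχ => hdeg χ (List.mem_cons_of_mem _ hχ))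
      (fun χ hχ => hdeg' χ (List.mem_cons_of_mem _ hχ))
    have hL : ∀ c ∈ ((C.filter (·.gate = ψ)).map fun c => (c.asg, c.val)).dedup,
        PairHolds ψ c ∧ ∀ x ∉ ψ.free, c.1 x = 0 := by
      intro c hc
      obtain ⟨d, hd, rfl⟩ := List.mem_map.1 (List.mem_dedup.1 hc)
      obtain ⟨hd, hdψ⟩ := List.mem_filter.1 hd
      have hdψ : d.gate = ψ := by simpa using hdψ
      rw [← hdψ]
      exact hC d hd
    rw [certifyAssignments]
    split
    · exact ih C hC
    · next hne =>
      refine (succeeds_merge (hdeg ψ List.mem_cons_self) (fun c hc => (hL c hc).1) hne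
        (List.nodup_dedup _) fun c hc => (hL c hc).2).bind fun c hc => ?_
      refine (succeeds_propagate (hdeg' ψ List.mem_cons_self) hc).bind fun C' hC' => ih _ ?_
      intro d hd
      rcases List.mem_append.1 hd with hd | hd
      · exact hC d hd
      · exact hC' d hd

end Completeness

end Rounds

/-! ### Normalizing claims -/

section Normalize

open GBC Program EvalClaim

variable {n p : ℕ}

/-- A gate of degree at most one in each variable computes a multiaffine function. -/
theorem isMultiaffine_eval {ψ : GBC n} (h : ∀ x, DegreeInLE p ψ x 1) :
    IsMultiaffine fun σ : Assignment n p => eval σ (ψ.arith p) := by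
  intro σ x
  have hlin := Polynomial.eq_X_add_C_of_natDegree_le_one (h x σ)
  simp only
  rw [← eval_evalExcept_self σ x, ← eval_evalExcept σ x, ← eval_evalExcept σ x, hlin]
  simp
  ring

/-- Gates of degree at most one in each variable have the same boolean function if and only if their
arithmetizations agree at all points over the field. -/
theorem fn_eq_iff [Fact p.Prime] {ψ₁ ψ₂ : GBC n} (h₁ : ∀ x, DegreeInLE p ψ₁ x 1)
    (h₂ : ∀ x, DegreeInLE p ψ₂ x 1) :
    ψ₁.fn = ψ₂.fn ↔ ∀ σ : Assignment n p, eval σ (ψ₁.arith p) = eval σ (ψ₂.arith p) := by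
  constructor
  · intro h σ
    refine sub_eq_zero.1 (((isMultiaffine_eval h₁).sub (isMultiaffine_eval h₂)).eq_zero
      (fun τ => ?_) σ)
    rw [eval_arith_boolVal, eval_arith_boolVal, h, sub_self]
  · intro h
    funext τ
    apply boolVal_injective (ZMod p)
    rw [← eval_arith_boolVal, ← eval_arith_boolVal, h]

/-- The number of satisfying assignments of the free variables. -/
def satCount (ψ : GBC n) : ℕ :=
  Fintype.card {τ : {x // x ∈ ψ.free} → Bool //
    ψ.fn (fun x => if h : x ∈ ψ.free then τ ⟨x, h⟩ else false) = true}

theorem satCount_le (ψ : GBC n) : satCount ψ ≤ 2 ^ n := by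
  refine (Fintype.card_subtype_le _).trans ?_
  rw [Fintype.card_fun, Fintype.card_bool, Fintype.card_coe]
  exact Nat.pow_le_pow_right two_pos ((Finset.card_le_univ _).trans_eq (Fintype.card_fin n))

theorem two_mul_inv_two [Fact p.Prime] (hp2 : p ≠ 2) : (2 : ZMod p) * 2⁻¹ = 1 :=
  mul_inv_cancel₀ fun h => hp2 ((Nat.prime_dvd_prime_iff_eq Fact.out Nat.prime_two).1
    ((ZMod.natCast_eq_zero_iff 2 p).1 (by exact_mod_cast h)))

/-- Counting by a single evaluation: at the centre of the cube a multiaffine function takes the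
average of its boolean values. -/
theorem eval_inv_two [Fact p.Prime] (hp2 : p ≠ 2) {ψ : GBC n} (h : ∀ x, DegreeInLE p ψ x 1) :
    eval (fun _ => 2⁻¹) (ψ.arith p) = (satCount ψ : ZMod p) * 2⁻¹ ^ ψ.free.card := by
  let ext : ({x // x ∈ ψ.free} → ZMod p) → Assignment n p :=
    fun ρ x => if h : x ∈ ψ.free then ρ ⟨x, h⟩ else 0
  have hext : ∀ ρ i a, ext (Function.update ρ i a) = Function.update (ext ρ) i.1 a := by
    intro ρ i a
    funext x
    rcases eq_or_ne x i.1 with rfl | hx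
    · simp [ext]
    · by_cases hf : x ∈ ψ.free
      · have : (⟨x, hf⟩ : {x // x ∈ ψ.free}) ≠ i := fun e => hx (congrArg Subtype.val e)
        simp [ext, hf, hx, this]
      · simp [ext, hf, hx]
  have haff : IsMultiaffine fun ρ => eval (ext ρ) (ψ.arith p) := by
    intro ρ i
    simp only
    rw [hext, hext]
    have := isMultiaffine_eval h (ext ρ) i.1
    rwa [show ext ρ i.1 = ρ i by simp [ext]] at this
  have hsum := haff.sum_boolVal (two_mul_inv_two hp2)
  have hval : ∀ τ : {x // x ∈ ψ.free} → Bool,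
      eval (ext fun i => boolVal (ZMod p) (τ i)) (ψ.arith p) = if ψ.fn (fun x =>
        if h : x ∈ ψ.free then τ ⟨x, h⟩ else false) = true then 1 else 0 := by
    intro τ
    rw [show (ext fun i => boolVal (ZMod p) (τ i)) = fun x => boolVal (ZMod p)
      (if h : x ∈ ψ.free then τ ⟨x, h⟩ else false) from ?_, eval_arith_boolVal, boolVal]
    funext x
    by_cases hf : x ∈ ψ.free <;> simp [ext, hf]
  have hcentre : eval (ext fun _ => 2⁻¹) (ψ.arith p) = eval (fun _ => 2⁻¹) (ψ.arith p) :=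
    eval_arith_congr ψ fun x hx => by simp [ext, hx]
  rw [Finset.sum_congr rfl fun τ _ => hval τ, Finset.sum_boole, ← Fintype.card_subtype,
    hcentre, Fintype.card_coe] at hsum
  rw [satCount, hsum, mul_right_comm, ← mul_pow, two_mul_inv_two hp2, one_pow, one_mul]

/-- A count claim is equivalent to the evaluation claim that replaces it, since the number of
satisfying assignments is at most `2 ^ n` and therefore less than `p`. -/
theorem eval_inv_two_eq_iff [Fact p.Prime] (hp : 2 ^ n ≤ p) (hp2 : p ≠ 2) {ψ : GBC n}
    (h : ∀ x, DegreeInLE p ψ x 1) {k : ℕ} (hk : k < p) :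
    eval (fun _ => 2⁻¹) (ψ.arith p) = (k : ZMod p) * 2⁻¹ ^ ψ.free.card ↔ satCount ψ = k := by
  have hlt : satCount ψ < p := by
    refine lt_of_le_of_ne ((satCount_le ψ).trans hp) fun he => ?_
    -- equality would make the odd prime `p` a power of two
    have hpow : p = 2 ^ n := le_antisymm (he ▸ satCount_le ψ) hp
    have hprime : p.Prime := Fact.out
    exact hp2 ((Nat.prime_dvd_prime_iff_eq hprime Nat.prime_two).1
      (hprime.dvd_of_dvd_pow (dvd_of_eq hpow)))
  have hinv : (2⁻¹ : ZMod p) ^ ψ.free.card ≠ 0 :=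
    pow_ne_zero _ (right_ne_zero_of_mul_eq_one (two_mul_inv_two hp2))
  rw [eval_inv_two hp2 h, mul_left_inj' hinv, ZMod.natCast_eq_natCast_iff',
    Nat.mod_eq_of_lt hlt, Nat.mod_eq_of_lt hk]

/-- Normalization introduces only claims about the gates of the given claim. -/
theorem failLe_normalizeClaim_gates [Fact p.Prime] (c : Claim n p) :
    FailLe (fun C' => ∀ c' ∈ C', c'.gate ∈ c.gates) (normalizeClaim c) 0 := by
  cases c with
  | fieldEval ψ σ k => exact .pure (by simp [Claim.gates])
  | boolEval ψ τ b => exact .pure (by simp [Claim.gates])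
  | count ψ k => exact .pure (by simp [Claim.gates])
  | equiv ψ₁ ψ₂ =>
    refine .sampleAssignment (m := 0) (k := 0) ∅ (by simp) fun σ _ => ?_
    refine .ask fun (a : ZMod p) => .ask fun (b : ZMod p) => ?_
    by_cases h : a = b
    · rw [if_pos h]; exact .pure (by simp [Claim.gates])
    · rw [if_neg h]; exact .reject
  | nequiv ψ₁ ψ₂ =>
    refine .ask fun (σ : Assignment n p) => .ask fun (a : ZMod p) => .ask fun (b : ZMod p) => ?_
    by_cases h : a ≠ b
    · rw [if_pos h]; exact .pure (by simp [Claim.gates])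
    · rw [if_neg h]; exact .reject

/-- Normalization turns a false claim into a false evaluation claim, except with probability
`n / p` that the random point does not distinguish two different functions. -/
theorem failLe_normalizeClaim [Fact p.Prime] (hp : 2 ^ n ≤ p) (hp2 : p ≠ 2) {c : Claim n p}
    (hr : c.InRange) (hdeg : ∀ ψ ∈ c.gates, ∀ x, DegreeInLE p ψ x 1) (hc : ¬ c.Holds) :
    FailLe (fun C' => (∃ c' ∈ C', ¬ c'.Holds) ∧ ∀ c' ∈ C', c'.gate ∈ c.gates)
      (normalizeClaim c) n := by
  cases c with
  | fieldEval ψ σ k =>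
    exact .pure ⟨⟨_, List.mem_singleton_self _, by rwa [holds_mk']⟩, by simp [Claim.gates]⟩
  | boolEval ψ τ b =>
    refine .pure ⟨⟨_, List.mem_singleton_self _, ?_⟩, by simp [Claim.gates]⟩
    rw [holds_mk', eval_arith_boolVal]
    exact fun h => hc (boolVal_injective _ h)
  | count ψ k =>
    refine .pure ⟨⟨_, List.mem_singleton_self _, ?_⟩, by simp [Claim.gates]⟩
    rw [holds_mk', eval_inv_two_eq_iff hp hp2 (hdeg ψ (by simp [Claim.gates])) hr]
    exact hc
  | equiv ψ₁ ψ₂ =>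
    have h₁ := hdeg ψ₁ (by simp [Claim.gates])
    have h₂ := hdeg ψ₂ (by simp [Claim.gates])
    rw [Claim.Holds, fn_eq_iff h₁ h₂] at hc
    push Not at hc
    obtain ⟨σ₀, hσ₀⟩ := hc
    have hcard := ((isMultiaffine_eval h₁).sub (isMultiaffine_eval h₂)).card_zeros_le
      (sub_ne_zero.2 hσ₀)
    rw [ZMod.card, Fintype.card_fin] at hcard
    refine .sampleAssignment (k := 0) _ hcard fun σ hσ =>
      .ask fun (a : ZMod p) => .ask fun (b : ZMod p) => ?_
    by_cases h : a = b
    · rw [if_pos h]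
      refine .pure ⟨?_, by simp [Claim.gates]⟩
      by_contra! hall
      have e₁ := hall (mk' ψ₁ σ a) (by simp)
      have e₂ := hall (mk' ψ₂ σ b) (by simp)
      rw [holds_mk'] at e₁ e₂
      exact hσ (by simp [e₁, e₂, h])
    · rw [if_neg h]; exact .reject
  | nequiv ψ₁ ψ₂ =>
    rw [Claim.Holds, ne_eq, not_not, fn_eq_iff (hdeg ψ₁ (by simp [Claim.gates]))
      (hdeg ψ₂ (by simp [Claim.gates]))] at hc
    refine .ask fun (σ : Assignment n p) => .ask fun (a : ZMod p) => .ask fun (b : ZMod p) => ?_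
    by_cases h : a ≠ b
    · rw [if_pos h]
      refine .pure ⟨?_, by simp [Claim.gates]⟩
      by_contra! hall
      have e₁ := hall (mk' ψ₁ σ a) (by simp)
      have e₂ := hall (mk' ψ₂ σ b) (by simp)
      rw [holds_mk'] at e₁ e₂
      exact h (by rw [← e₁, ← e₂, hc])
    · rw [if_neg h]; exact .reject

theorem failLe_normalizeClaims_gates [Fact p.Prime] {S : Finset (GBC n)}
    {claims : List (Claim n p)} (hS : ∀ c ∈ claims, c.gates ⊆ S) :
    FailLe (fun C => ∀ c ∈ C, c.gate ∈ S) (normalizeClaims claims) 0 := by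
  induction claims with
  | nil => exact .pure (by simp)
  | cons c cs ih =>
    refine (failLe_normalizeClaim_gates c).bind (l := 0) fun C₁ h₁ =>
      (ih fun d hd => hS d (List.mem_cons_of_mem _ hd)).bind (l := 0) fun C₂ h₂ => .pure ?_
    intro d hd
    rcases List.mem_append.1 hd with hd | hd
    · exact hS c List.mem_cons_self (h₁ d hd)
    · exact h₂ d hd

/-- It suffices to follow one false claim, so the error does not depend on the number of claims. -/
theorem failLe_normalizeClaims [Fact p.Prime] (hp : 2 ^ n ≤ p) (hp2 : p ≠ 2)
    {S : Finset (GBC n)} (hdeg : ∀ ψ ∈ S, ∀ x, DegreeInLE p ψ x 1) {claims : List (Claim n p)}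
    (hS : ∀ c ∈ claims, c.InRange ∧ c.gates ⊆ S) (hc : ∃ c ∈ claims, ¬ c.Holds) :
    FailLe (fun C => (∃ c ∈ C, ¬ c.Holds) ∧ ∀ c ∈ C, c.gate ∈ S) (normalizeClaims claims) n := by
  induction claims with
  | nil => simp at hc
  | cons c cs ih =>
    obtain ⟨hr, hcS⟩ := hS c List.mem_cons_self
    have hS' := fun d hd => hS d (List.mem_cons_of_mem c hd)
    by_cases h : c.Holds
    · have hcs : ∃ d ∈ cs, ¬ d.Holds := by
        obtain ⟨d, hd, hdf⟩ := hc
        rcases List.mem_cons.1 hd with rfl | hd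
        · exact absurd h hdf
        · exact ⟨d, hd, hdf⟩
      refine FailLe.mono (k := 0 + (n + 0)) ?_ (fun _ h => h) (by simp)
      refine (failLe_normalizeClaim_gates c).bind fun C₁ h₁ =>
        (ih hS' hcs).bind fun C₂ ⟨⟨d, hd, hdf⟩, h₂⟩ =>
          .pure ⟨⟨d, List.mem_append_right _ hd, hdf⟩, fun e he => ?_⟩
      rcases List.mem_append.1 he with he | he
      · exact hcS (h₁ e he)
      · exact h₂ e he
    · refine FailLe.mono (k := n + (0 + 0)) ?_ (fun _ h => h) (by simp)
      refine (failLe_normalizeClaim hp hp2 hr (fun ψ hψ => hdeg ψ (hcS hψ)) h).bind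
        fun C₁ ⟨⟨d, hd, hdf⟩, h₁⟩ => (failLe_normalizeClaims_gates fun d hd => (hS' d hd).2).bind
          fun C₂ h₂ => .pure ⟨⟨d, List.mem_append_left _ hd, hdf⟩, fun e he => ?_⟩
      rcases List.mem_append.1 he with he | he
      · exact hcS (h₁ e he)
      · exact h₂ e he

theorem succeeds_normalizeClaim [Fact p.Prime] (hp : 2 ^ n ≤ p) (hp2 : p ≠ 2) {c : Claim n p}
    (hr : c.InRange) (hdeg : ∀ ψ ∈ c.gates, ∀ x, DegreeInLE p ψ x 1) (hc : c.Holds) :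
    Succeeds (fun C' => ∀ c' ∈ C', c'.Holds ∧ c'.Blanked) (normalizeClaim c) := by
  have single : ∀ {χ : GBC n} {ρ : Assignment n p} {a : ZMod p}, eval ρ (χ.arith p) = a →
      ∀ c ∈ [mk' χ ρ a], c.Holds ∧ c.Blanked := fun hv c hc => by
    rw [List.mem_singleton.1 hc]
    exact ⟨holds_mk'.2 hv, blanked_mk' _ _ _⟩
  have double : ∀ {χ χ' : GBC n} {ρ : Assignment n p} {a b : ZMod p}, a = eval ρ (χ.arith p) →
      b = eval ρ (χ'.arith p) → ∀ c ∈ [mk' χ ρ a, mk' χ' ρ b], c.Holds ∧ c.Blanked :=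
      fun ha hb c hc => by
    rcases List.mem_cons.1 hc with hc | hc
    · exact single ha.symm c (List.mem_singleton.2 hc)
    · exact single hb.symm c hc
  cases c with
  | fieldEval ψ σ k => exact .pure (single hc)
  | boolEval ψ τ b => exact .pure (single (by rw [eval_arith_boolVal, show ψ.fn τ = b from hc]))
  | count ψ k =>
    exact .pure (single ((eval_inv_two_eq_iff hp hp2 (hdeg ψ (by simp [Claim.gates])) hr).2 hc))
  | equiv ψ₁ ψ₂ =>
    rw [Claim.Holds, fn_eq_iff (hdeg ψ₁ (by simp [Claim.gates]))
      (hdeg ψ₂ (by simp [Claim.gates]))] at hc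
    refine .sampleAssignment fun σ => .ask fun (a : ZMod p) ha => .ask fun (b : ZMod p) hb => ?_
    replace ha : a = eval σ (ψ₁.arith p) := ha
    replace hb : b = eval σ (ψ₂.arith p) := hb
    rw [if_pos (by rw [ha, hb, hc])]
    exact .pure (double ha hb)
  | nequiv ψ₁ ψ₂ =>
    rw [Claim.Holds, ne_eq, fn_eq_iff (p := p) (hdeg ψ₁ (by simp [Claim.gates]))
      (hdeg ψ₂ (by simp [Claim.gates]))] at hc
    push Not at hc
    refine .ask fun (σ : Assignment n p) hσ => .ask fun (a : ZMod p) ha =>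
      .ask fun (b : ZMod p) hb => ?_
    replace hσ : eval σ (ψ₁.arith p) ≠ eval σ (ψ₂.arith p) := hσ hc
    replace ha : a = eval σ (ψ₁.arith p) := ha
    replace hb : b = eval σ (ψ₂.arith p) := hb
    rw [if_pos (by rwa [ha, hb])]
    exact .pure (double ha hb)

theorem succeeds_normalizeClaims [Fact p.Prime] (hp : 2 ^ n ≤ p) (hp2 : p ≠ 2)
    {S : Finset (GBC n)} (hdeg : ∀ ψ ∈ S, ∀ x, DegreeInLE p ψ x 1) {claims : List (Claim n p)}
    (hS : ∀ c ∈ claims, c.InRange ∧ c.gates ⊆ S) (hc : ∀ c ∈ claims, c.Holds) :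
    Succeeds (fun C => ∀ c ∈ C, c.Holds ∧ c.Blanked) (normalizeClaims claims) := by
  induction claims with
  | nil => exact .pure (by simp)
  | cons c cs ih =>
    obtain ⟨hr, hcS⟩ := hS c List.mem_cons_self
    refine (succeeds_normalizeClaim hp hp2 hr (fun ψ hψ => hdeg ψ (hcS hψ))
      (hc c List.mem_cons_self)).bind fun C₁ h₁ =>
      (ih (fun d hd => hS d (List.mem_cons_of_mem _ hd))
        (fun d hd => hc d (List.mem_cons_of_mem _ hd))).bind fun C₂ h₂ => .pure fun d hd => ?_
    rcases List.mem_append.1 hd with hd | hd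
    · exact h₁ d hd
    · exact h₂ d hd

end Normalize

/-! ### Soundness and completeness of the protocol -/

theorem mainTheorem1 (n p : ℕ) [Fact p.Prime] (hp : 2 ^ n ≤ p) (hp2 : p ≠ 2)
    (φ : Finset (GBC n)) (hφ : ∀ χ ∈ φ, χ.IsExpr)
    (order : List (GBC n))
    (horder : IsTopologicalOrder (circuitGates (φ.image GBC.conv)) order)
    (claims : List (Claim n p))
    (hclaims : ∀ c ∈ claims, c.InRange ∧ c.gates ⊆ (circuitGates φ).image GBC.conv) :
    ((∃ c ∈ claims, ¬ c.Holds) →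
      ∀ P : Prover n p, (acceptProb P order claims).toReal ≤
        (4 * n * (circuitGates φ).card + n : ℝ) / p) ∧
    ((∀ c ∈ claims, c.Holds) →
      (∃ P : Prover n p, P.Honest) ∧
      ∀ P : Prover n p, P.Honest → acceptProb P order claims = 1) := by
  obtain ⟨hnodup, hmem, htop⟩ := horder
  have hdeg : ∀ ψ ∈ principalGates φ, ∀ x, DegreeInLE p ψ x 1 := by
    intro ψ hψ x
    obtain ⟨a, ha, rfl⟩ := Finset.mem_image.1 hψ
    exact degreeInLE_conv (isExpr_of_mem_circuitGates hφ ha) x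
  have hclosed : ∀ ψ ∈ order, ∀ c ∈ ψ.children, c ∈ order := fun ψ hψ c hc =>
    (hmem c).2 (children_subset_circuitGates ((hmem ψ).1 hψ) hc)
  refine ⟨fun hfalse P => ?_, fun htrue => ⟨Prover.exists_honest n p, fun P hP => ?_⟩⟩
  · have hfail : Program.FailLe (fun _ => False) (certify order claims)
        (n + (order.map (gateCost φ)).sum) := by
      refine (failLe_normalizeClaims hp hp2 hdeg hclaims hfalse).bind
        fun C ⟨⟨c, hc, hcf⟩, hgates⟩ => failLe_certifyAssignments hφ (fun ψ => (hmem ψ).1) htop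
          hclosed (fun ψ hψ => ?_)
          ⟨c, hc, (hmem _).2 (principalGates_subset φ (hgates c hc)), hcf⟩
      have h1 : C.filter (·.gate = ψ) = [] := List.filter_eq_nil_iff.2 fun c hc => by
        simp only [decide_eq_true_eq]
        exact fun h => hψ (h ▸ hgates c hc)
      rw [h1, List.length_nil, zero_add, ← List.toFinset_card_of_nodup (hnodup.filter _),
        Finset.card_le_one]
      intro a ha b hb
      simp only [List.mem_toFinset, List.mem_filter, decide_eq_true_eq, hmem] at ha hb
      exact delta_parent_unique hφ ha.1 hb.1 ha.2 hb.2 (isDelta_of_child_notMem hφ ha.1 ha.2 hψ)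
        (isDelta_of_child_notMem hφ hb.1 hb.2 hψ)
    have hsum : (order.map (gateCost φ)).sum ≤ 4 * n * (circuitGates φ).card := by
      have horder' : order.toFinset = reducedGates φ := by
        ext ψ
        rw [List.mem_toFinset, hmem]
      rw [← List.sum_toFinset _ hnodup, horder']
      exact sum_gateCost_le hφ
    have hle : acceptProb P order claims
        ≤ ((4 * n * (circuitGates φ).card + n : ℕ) : ENNReal) / p :=
      (hfail.mono (fun _ h => h) (by omega)).run_le P [] ()
    have hp0 : (p : ENNReal) ≠ 0 := by exact_mod_cast (Fact.out : p.Prime).ne_zero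
    refine (ENNReal.toReal_mono (ENNReal.div_ne_top (by finiteness) hp0) hle).trans (le_of_eq ?_)
    rw [ENNReal.toReal_div, ENNReal.toReal_natCast, ENNReal.toReal_natCast]
    push_cast
    ring
  · have hdeg2 : ∀ ψ ∈ order, ∀ x, DegreeInLE p ψ x 2 := fun ψ hψ =>
      degreeInLE_of_mem_reducedGates hφ ((hmem ψ).1 hψ)
    exact ((succeeds_normalizeClaims hp hp2 hdeg hclaims htrue).bind fun C hC =>
      succeeds_certifyAssignments hdeg2 (fun ψ hψ c hc => hdeg2 c (hclosed ψ hψ c hc))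
        hC).run_eq_one hP []
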